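/- Let $\mathsf{RCA}_0^\omega=\mathsf{E\text{-}PRA}^\omega+\mathsf{QF\text{-}AC}^{1,0}$ be Kohlenbach's base theory of higher-order Reverse Mathematics: classical many-sorted logic over the finite types generated from the type $0$ of natural numbers, with equality primitive at type $0$ only and defined extensionally at higher types, with $0$, successor, the typed combinators $\Pi,\Sigma$ and the recursor $R_0$ (primitive recursion with values of type $0$), with the axiom of extensionality at all types, induction for quantifier-free formulas, and the choice schema $(\forall f^1)(\exists n^0)A(f,n)\to(\exists F^2)(\forall f^1)A(f,F(f))$ for quantifier-free $A$. Here $1$ is the type $0\to 0$ and $2$ is the type $1\to 0$. A set $X$ is given by its binary characteristic function of type $1$, and $n\in X$ means $X(n)=1$. With the pairing $(i,j)=(i+j)^2+i$, write $i\le_X j$ for $(i,j)\in X$ and $\mathrm{field}(X)=\{i:(i,i)\in X\}$; $X$ is a linear order if $i\le_X j$ implies $i,j\in\mathrm{field}(X)$, $\le_X$ is transitive and antisymmetric (with respect to equality of numbers), and any two elements of $\mathrm{field}(X)$ are comparable. $\mathrm{Seq}(X)$ is the class of sequences $x_{(\cdot)}$ of type $1$ with $x_n\in\mathrm{field}(X)$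 for all $n$. For $\Phi$ of type $1\to(2\to 1)$ let $\mathsf{UADS}_2(\Phi)$ be the formula: for all linear orders $X^1$ and all $g^2$, $$(\forall x_{(\cdot)}\in\mathrm{Seq}(X))(\exists n,k\le g(x_{(\cdot)}))\,(x_n\le_X x_{n+1}\wedge x_k\ge_X x_{k+1})\ \to\ (\forall m\in\mathrm{field}(X))\,(\Phi(X,g)(1)\le_X m\le_X\Phi(X,g)(2)),$$ and for $\mu$ of type $2$ let $\mathsf{MU}(\mu)$ be the formula $(\forall f^1)\big((\exists n)f(n)=0\to f(\mu(f))=0\big)$. Let $\mathsf{UADS}_2$ be $(\exists\Phi)\,\mathsf{UADS}_2(\Phi)$ and let $(\mu^2)$ be $(\exists\mu^2)\,\mathsf{MU}(\mu)$. **Theorem.** $\mathsf{RCA}_0^\omega$ proves $\mathsf{UADS}_2\leftrightarrow(\mu^2)$, and both implications are explicit: there are closed terms $t$ and $s$ of the language such that $\mathsf{RCA}_0^\omega$ proves $$(\forall\Phi)\big[\mathsf{UADS}_2(\Phi)\to\mathsf{MU}(t(\Phi))\big]\quad\text{and}\quad(\forall\mu^2)\big[\mathsf{MU}(\mu)\to\mathsf{UADS}_2(s(\mu))\big].$$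 -/

import Mathlib

namespace HigherOrder

/-! ## Finite types, terms and formulas of higher-order arithmetic -/

/-- The finite types: the type `0` of natural numbers, and function types. -/
inductive Ty : Type
  | nat : Ty
  | arr : Ty → Ty → Ty
  deriving DecidableEq

infixr:60 " ⇾ " => Ty.arr

/-- The type `1 = 0 → 0`. -/
abbrev Ty.one : Ty := Ty.nat ⇾ Ty.nat

/-- The type `2 = (0 → 0) → 0`. -/
abbrev Ty.two : Ty := Ty.one ⇾ Ty.nat

/-- Terms. Each type has its own countable supply of variables (de Bruijn indices, counted
separately for every type). The constants are `0`, successor, the combinators `Π` (here `K`) and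
`Σ` (here `S`), and the recursor `R₀` for primitive recursion with values of type `0`. -/
inductive Tm : Ty → Type
  | var (σ : Ty) (n : ℕ) : Tm σ
  | zero : Tm Ty.nat
  | succ : Tm (Ty.nat ⇾ Ty.nat)
  | K (σ τ : Ty) : Tm (σ ⇾ τ ⇾ σ)
  | S (ρ σ τ : Ty) : Tm ((ρ ⇾ σ ⇾ τ) ⇾ (ρ ⇾ σ) ⇾ ρ ⇾ τ)
  | R : Tm (Ty.nat ⇾ Ty.nat ⇾ (Ty.nat ⇾ Ty.nat ⇾ Ty.nat) ⇾ Ty.nat)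
  | app {σ τ : Ty} (f : Tm (σ ⇾ τ)) (a : Tm σ) : Tm τ

infixl:75 " ⬝ " => Tm.app

/-- A term is closed if no variable occurs in it. -/
def Tm.Closed : {σ : Ty} → Tm σ → Prop
  | _, .var _ _ => False
  | _, .zero => True
  | _, .succ => True
  | _, .K _ _ => True
  | _, .S _ _ _ => True
  | _, .R => True
  | _, .app f a => f.Closed ∧ a.Closed

/-- Simultaneous substitutions. -/
abbrev Sub : Type := (σ : Ty) → ℕ → Tm σ

/-- The identity substitution. -/
def Sub.id : Sub := fun σ n => .var σ n

/-- The substitution that makes room for a new variable `0` of type `σ`. -/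
def Sub.shift (σ : Ty) : Sub := fun τ n => if τ = σ then .var τ (n + 1) else .var τ n

/-- `Sub.cons t s` maps variable `0` of type `σ` to `t`, variable `n + 1` of type `σ` to the value
of `s` at `n`, and acts as `s` on the variables of all other types. -/
def Sub.cons {σ : Ty} (t : Tm σ) (s : Sub) : Sub := fun τ n =>
  if h : σ = τ then
    match n with
    | 0 => h ▸ t
    | n + 1 => s τ n
  else s τ n

/-- Applying a substitution to a term. -/
def Tm.subst (s : Sub) : {σ : Ty} → Tm σ → Tm σ
  | _, .var σ n => s σ n
  | _, .zero => .zero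
  | _, .succ => .succ
  | _, .K σ τ => .K σ τ
  | _, .S ρ σ τ => .S ρ σ τ
  | _, .R => .R
  | _, .app f a => .app (f.subst s) (a.subst s)

/-- Weakening a term by a new variable of type `σ`. -/
def Tm.lift (σ : Ty) {τ : Ty} (t : Tm τ) : Tm τ := t.subst (Sub.shift σ)

/-- Formulas of (classical) many-sorted predicate logic; the prime formulas are the equations
between terms of type `0`. In `all σ A` the bound variable is variable `0` of type `σ`. -/
inductive Form : Type
  | eq (a b : Tm Ty.nat) : Form
  | bot : Form
  | imp (A B : Form) : Form
  | all (σ : Ty) (A : Form) : Form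

infixr:55 " ⇛ " => Form.imp

namespace Form

/-- Negation. -/
def neg (A : Form) : Form := A ⇛ bot
/-- Conjunction (classical logic). -/
def and (A B : Form) : Form := neg (A ⇛ neg B)
/-- Disjunction (classical logic). -/
def or (A B : Form) : Form := neg A ⇛ B
/-- Equivalence. -/
def iff (A B : Form) : Form := and (A ⇛ B) (B ⇛ A)
/-- Existential quantification (classical logic). -/
def ex (σ : Ty) (A : Form) : Form := neg (all σ (neg A))

/-- Quantifier-free formulas. -/
def QF : Form → Prop
  | eq _ _ => True
  | bot => True
  | imp A B => A.QF ∧ B.QF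
  | all _ _ => False

end Form

/-- Pushing a substitution below a quantifier over type `σ`. -/
def Sub.under (σ : Ty) (s : Sub) : Sub := Sub.cons (.var σ 0) (fun τ n => (s τ n).lift σ)

/-- Applying a substitution to a formula. -/
def Form.subst : Form → Sub → Form
  | .eq a b, s => .eq (a.subst s) (b.subst s)
  | .bot, _ => .bot
  | .imp A B, s => .imp (A.subst s) (B.subst s)
  | .all σ A, s => .all σ (A.subst (s.under σ))

/-- Weakening a formula by a new variable of type `σ`. -/
def Form.lift (σ : Ty) (A : Form) : Form := A.subst (Sub.shift σ)

/-- Instantiating the variable `0` of type `σ`, as bound by a quantifier, by a term. -/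
def Form.inst {σ : Ty} (A : Form) (t : Tm σ) : Form := A.subst (Sub.cons t Sub.id)

/-! ## Classical provability -/

/-- Classical natural deduction: `Deriv T Γ A` means that `A` is derivable from the axioms in `T`
(whose free variables are read universally) and the hypotheses `Γ`. -/
inductive Deriv (T : Set Form) : List Form → Form → Prop
  | ax {Γ : List Form} {A : Form} : A ∈ T → Deriv T Γ A
  | hyp {Γ : List Form} {A : Form} : A ∈ Γ → Deriv T Γ A
  | impI {Γ : List Form} {A B : Form} : Deriv T (A :: Γ) B → Deriv T Γ (A ⇛ B)
  | impE {Γ : List Form} {A B : Form} : Deriv T Γ (A ⇛ B) → Deriv T Γ A → Deriv T Γ B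
  | raa {Γ : List Form} {A : Form} : Deriv T (A.neg :: Γ) .bot → Deriv T Γ A
  | allI {Γ : List Form} {σ : Ty} {A : Form} :
      Deriv T (Γ.map (Form.lift σ)) A → Deriv T Γ (.all σ A)
  | allE {Γ : List Form} {σ : Ty} {A : Form} (t : Tm σ) :
      Deriv T Γ (.all σ A) → Deriv T Γ (A.inst t)

/-- `A` is a theorem of the theory `T`. -/
def Proves (T : Set Form) (A : Form) : Prop := Deriv T [] A

/-! ## The base theory -/

/-- Equality at an arbitrary type, `x =_τ y`, defined extensionally from equality at type `0`:
`∀ z₁ … z_k, x z₁ … z_k =₀ y z₁ … z_k`. -/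
def Form.eqAt : (τ : Ty) → Tm τ → Tm τ → Form
  | .nat, a, b => .eq a b
  | .arr σ τ, a, b => .all σ (Form.eqAt τ (a.lift σ ⬝ .var σ 0) (b.lift σ ⬝ .var σ 0))

/-- The axioms of `RCA₀^ω = E-PRA^ω + QF-AC^{1,0}`: equality at type `0`, successor, the defining
equations of the combinators and of `R₀`, extensionality at all types, quantifier-free induction,
and quantifier-free choice from type `1` to type `0`. -/
inductive RCA0ω : Set Form
  | refl (a : Tm .nat) : RCA0ω (.eq a a)
  | symm (a b : Tm .nat) : RCA0ω (.eq a b ⇛ .eq b a)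
  | trans (a b c : Tm .nat) : RCA0ω (.eq a b ⇛ .eq b c ⇛ .eq a c)
  | succ_ne_zero (a : Tm .nat) : RCA0ω (Form.neg (.eq (.succ ⬝ a) .zero))
  | succ_inj (a b : Tm .nat) : RCA0ω (.eq (.succ ⬝ a) (.succ ⬝ b) ⇛ .eq a b)
  | K_eq {σ τ : Ty} (a : Tm σ) (b : Tm τ) : RCA0ω (.eqAt σ (.K σ τ ⬝ a ⬝ b) a)
  | S_eq {ρ σ τ : Ty} (a : Tm (ρ ⇾ σ ⇾ τ)) (b : Tm (ρ ⇾ σ)) (c : Tm ρ) :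
      RCA0ω (.eqAt τ (.S ρ σ τ ⬝ a ⬝ b ⬝ c) (a ⬝ c ⬝ (b ⬝ c)))
  | R_zero (y : Tm .nat) (z : Tm (.nat ⇾ .nat ⇾ .nat)) :
      RCA0ω (.eq (.R ⬝ .zero ⬝ y ⬝ z) y)
  | R_succ (x y : Tm .nat) (z : Tm (.nat ⇾ .nat ⇾ .nat)) :
      RCA0ω (.eq (.R ⬝ (.succ ⬝ x) ⬝ y ⬝ z) (z ⬝ (.R ⬝ x ⬝ y ⬝ z) ⬝ x))
  | ext {σ τ : Ty} (f : Tm (σ ⇾ τ)) (a b : Tm σ) :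
      RCA0ω (.eqAt σ a b ⇛ .eqAt τ (f ⬝ a) (f ⬝ b))
  /-- `A(0) ∧ ∀ x (A(x) → A(Sx)) → ∀ x A(x)`, for quantifier-free `A` with arbitrary parameters;
  `x` is variable `0` of type `0`. -/
  | qf_ind (A : Form) : A.QF →
      RCA0ω (A.inst Tm.zero ⇛
        .all .nat (A ⇛ A.subst (Sub.cons (.succ ⬝ .var .nat 0) (Sub.shift .nat))) ⇛
        .all .nat A)
  /-- `∀ f¹ ∃ n⁰ A(f, n) → ∃ F² ∀ f¹ A(f, F(f))`, for quantifier-free `A` with arbitrary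
  parameters; `f` and `n` are the variables `0` of types `1` and `0`. -/
  | qf_ac (A : Form) : A.QF →
      RCA0ω (.all .one (.ex .nat A) ⇛
        .ex .two (.all .one
          (A.subst (Sub.cons (.var .two 0 ⬝ .var .one 0) (Sub.shift .two)))))

/-- Let `A` be a formula in the variable `Φ` (variable `0` of type `σ`) and `B` a formula in the
variable `Ψ` (variable `0` of type `τ`). The implication `∃ Φ A(Φ) → ∃ Ψ B(Ψ)` is explicit over
`T` if `T` proves it and, additionally, `T` proves `∀ Φ (A(Φ) → B(t(Φ)))` for some closed term
`t` of the language. -/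
def ExplicitImp (T : Set Form) (σ τ : Ty) (A B : Form) : Prop :=
  Proves T (.ex σ A ⇛ .ex τ B) ∧
  ∃ t : Tm (σ ⇾ τ), t.Closed ∧
    Proves T (.all σ (A ⇛ B.subst (Sub.cons (t ⬝ .var σ 0) (Sub.shift σ))))

/-! ## Arithmetic, sets and linear orders -/

namespace Tm

/-- The numeral `1`. -/
def one : Tm .nat := .succ ⬝ .zero
/-- The numeral `2`. -/
def two : Tm .nat := .succ ⬝ one

/-- The identity `λ x⁰. x`. -/
def idN : Tm (.nat ⇾ .nat) := .S .nat (.nat ⇾ .nat) .nat ⬝ .K .nat (.nat ⇾ .nat) ⬝ .K .nat .nat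

/-- For `h` of type `0 → 0`, the step function `λ r i. h(r)`. -/
def step (h : Tm (.nat ⇾ .nat)) : Tm (.nat ⇾ .nat ⇾ .nat) :=
  .S .nat .nat (.nat ⇾ .nat) ⬝ (.K (.nat ⇾ .nat ⇾ .nat) .nat ⬝ .K .nat .nat) ⬝ h

/-- Addition, by recursion on `b`. -/
def add (a b : Tm .nat) : Tm .nat := .R ⬝ b ⬝ a ⬝ step .succ

/-- The function `λ r. r + a`. -/
def addRight (a : Tm .nat) : Tm (.nat ⇾ .nat) :=
  .S .nat (.nat ⇾ .nat ⇾ .nat) .nat ⬝ (.R ⬝ a) ⬝ (.K (.nat ⇾ .nat ⇾ .nat) .nat ⬝ step .succ)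

/-- Multiplication, by recursion on `b`. -/
def mul (a b : Tm .nat) : Tm .nat := .R ⬝ b ⬝ .zero ⬝ step (addRight a)

/-- The predecessor function `λ r. R₀ r 0 (λ x i. i)`. -/
def pred : Tm (.nat ⇾ .nat) :=
  .S .nat (.nat ⇾ .nat ⇾ .nat) .nat ⬝
    (.S .nat .nat ((.nat ⇾ .nat ⇾ .nat) ⇾ .nat) ⬝ .R ⬝ (.K .nat .nat ⬝ .zero)) ⬝
    (.K (.nat ⇾ .nat ⇾ .nat) .nat ⬝ (.K (.nat ⇾ .nat) .nat ⬝ idN))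

/-- Truncated subtraction, by recursion on `b`. -/
def sub (a b : Tm .nat) : Tm .nat := .R ⬝ b ⬝ a ⬝ step pred

/-- The pairing function `(i, j) = (i + j)² + i`. -/
def pair (i j : Tm .nat) : Tm .nat := add (mul (add i j) (add i j)) i

end Tm

namespace Form

/-- `a ≤ b` for numbers. -/
def le (a b : Tm .nat) : Form := .eq (Tm.sub a b) .zero

/-- `X` is (the binary characteristic function of) a set. -/
def isSet (X : Tm .one) : Form :=
  .all .nat (or (.eq (X.lift .nat ⬝ .var .nat 0) .zero) (.eq (X.lift .nat ⬝ .var .nat 0) Tm.one))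

/-- `n ∈ X`. -/
def mem (n : Tm .nat) (X : Tm .one) : Form := .eq (X ⬝ n) Tm.one

/-- `i ≤_X j`, that is, `(i, j) ∈ X`. -/
def leX (X : Tm .one) (i j : Tm .nat) : Form := mem (Tm.pair i j) X

/-- `i ∈ field(X)`, that is, `(i, i) ∈ X`. -/
def inField (X : Tm .one) (i : Tm .nat) : Form := leX X i i

/-- `LO(X)`: the set `X` is a linear order, i.e. reflexive (on its field), transitive,
antisymmetric and total. -/
def LO (X : Tm .one) : Form :=
  let Y := ((X.lift .nat).lift .nat).lift .nat
  let i : Tm .nat := .var .nat 2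
  let j : Tm .nat := .var .nat 1
  let k : Tm .nat := .var .nat 0
  and (isSet X) <| .all .nat <| .all .nat <| .all .nat <|
    and (leX Y i j ⇛ and (inField Y i) (inField Y j)) <|
    and (and (leX Y i j) (leX Y j k) ⇛ leX Y i k) <|
    and (and (leX Y i j) (leX Y j i) ⇛ .eq i j) <|
    and (inField Y i) (inField Y j) ⇛ or (leX Y i j) (leX Y j i)

/-- `x ∈ Seq(X)`: `x` is a sequence in the field of `X`. -/
def isSeq (X x : Tm .one) : Form :=
  .all .nat (inField (X.lift .nat) (x.lift .nat ⬝ .var .nat 0))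

/-- `(∃ n, k ≤ b) (x_n ≤_X x_{n+1} ∧ x_k ≥_X x_{k+1})`. -/
def notAscNotDesc (X x : Tm .one) (b : Tm .nat) : Form :=
  let Y := (X.lift .nat).lift .nat
  let y := (x.lift .nat).lift .nat
  let c := (b.lift .nat).lift .nat
  let n : Tm .nat := .var .nat 1
  let k : Tm .nat := .var .nat 0
  .ex .nat <| .ex .nat <|
    and (and (le n c) (le k c)) <|
    and (leX Y (y ⬝ n) (y ⬝ (.succ ⬝ n))) (leX Y (y ⬝ (.succ ⬝ k)) (y ⬝ k))

end Form

/-- The type `1 → (2 → 1)` of the functional `Φ³`; `Φ(X, g)(1)` and `Φ(X, g)(2)` are the values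
of `Φ(X, g)` at the numbers `1` and `2`. -/
abbrev Ty.bound : Ty := .one ⇾ .two ⇾ .one

/-- `UADS₂(Φ)`, in the variable `Φ` (variable `0` of type `1 → (2 → 1)`): for all linear orders
`X¹` and all `g²`, if every `x ∈ Seq(X)` satisfies
`(∃ n, k ≤ g(x)) (x_n ≤_X x_{n+1} ∧ x_k ≥_X x_{k+1})`, then
`Φ(X, g)(1) ≤_X m ≤_X Φ(X, g)(2)` for all `m ∈ field(X)`. -/
def UADS2Body : Form :=
  .all .one <| .all .two <|
    let Φ : Tm .bound := .var .bound 0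
    let g : Tm .two := .var .two 0
    let X : Tm .one := .var .one 0
    .LO X ⇛
      .all .one (.isSeq (X.lift .one) (.var .one 0) ⇛
        .notAscNotDesc (X.lift .one) (.var .one 0) (g ⬝ .var .one 0)) ⇛
      .all .nat (.inField X (.var .nat 0) ⇛
        .and (.leX X (Φ ⬝ X ⬝ g ⬝ Tm.one) (.var .nat 0))
          (.leX X (.var .nat 0) (Φ ⬝ X ⬝ g ⬝ Tm.two)))

/-- `MU(μ)`, in the variable `μ` (variable `0` of type `2`):
`∀ f¹ (∃ n f(n) = 0 → f(μ(f)) = 0)`. -/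
def MUBody : Form :=
  .all .one <|
    .ex .nat (.eq (.var .one 0 ⬝ .var .nat 0) .zero) ⇛
      .eq (.var .one 0 ⬝ (.var .two 0 ⬝ .var .one 0)) .zero

/-- The sentence `UADS₂`. -/
def UADS2 : Form := .ex .bound UADS2Body

/-- The sentence `(μ²)`. -/
def Mu2 : Form := .ex .two MUBody

end HigherOrder

/-! Provability is reduced to truth in all models by a completeness theorem, `proves_of_sat`. If `A`
is not provable, its negation lies in a Henkin set (`Consistent.exists_henkin`), and the terms
modulo the extensional equalities in that set form a model refuting `A` (`IsHenkin.sat_val`). What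
remains is mathematics inside an arbitrary, possibly nonstandard model: induction is restricted to
quantifier-free predicates, and every sequence or functional used must be an element of the model.

From `Φ` to `μ`: given `f`, let `X` be the order whose only possible element is the first zero of
`f`. It exists without knowing whether `f` has a zero, since a bounded search decides whether `(w,
w)` belongs to `X`. All sequences in `X` are constant, so `g = 0` satisfies the premise of `UADS₂`;
if `f` has a zero, a lower bound of the one-point order `X` is that zero (`isMu_muOfBound`).

From `μ` to `Φ`: being strictly below `m` in `X` is decidable, so `μ` finds an element strictly
below `m` if there is one, and hence decides whether there is one. A second application of `μ`
searches for an `m` in the field with nothing below it. If there were none, iterating the first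
search would give a strictly descending sequence in the model, against the premise
(`eval_extremum_spec`). By totality such an `m` is least, and the greatest element is found dually
(`isBound_boundOfMu`).

Both constructions are closed terms obtained by bracket abstraction, which makes the implications
explicit. -/

namespace HigherOrder

/-! ## Substitution -/

/-- Composition of substitutions: first `s`, then `s'`. -/
def Sub.comp (s s' : Sub) : Sub := fun σ n => (s σ n).subst s'

@[simp] theorem Sub.cons_zero {σ : Ty} (t : Tm σ) (s : Sub) : Sub.cons t s σ 0 = t := by
  simp [Sub.cons]

@[simp] theorem Sub.cons_succ {σ : Ty} (t : Tm σ) (s : Sub) (n : ℕ) :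
    Sub.cons t s σ (n + 1) = s σ n := by
  simp [Sub.cons]

theorem Sub.cons_of_ne {σ τ : Ty} (h : σ ≠ τ) (t : Tm σ) (s : Sub) (n : ℕ) :
    Sub.cons t s τ n = s τ n := by
  simp [Sub.cons, h]

@[simp] theorem Sub.shift_self (σ : Ty) (n : ℕ) : Sub.shift σ σ n = .var σ (n + 1) := by
  simp [Sub.shift]

theorem Sub.shift_of_ne {σ τ : Ty} (h : σ ≠ τ) (n : ℕ) : Sub.shift σ τ n = .var τ n := by
  simp [Sub.shift, h.symm]

/-- Two substitutions agree if they agree at variable `0` of type `σ`, at its successors, and at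
all other types. -/
theorem Sub.ext_cases {s s' : Sub} (σ : Ty) (h0 : s σ 0 = s' σ 0)
    (hs : ∀ n, s σ (n + 1) = s' σ (n + 1)) (hne : ∀ τ n, σ ≠ τ → s τ n = s' τ n) : s = s' := by
  funext τ n
  by_cases h : σ = τ
  · subst h
    cases n with
    | zero => exact h0
    | succ n => exact hs n
  · exact hne τ n h

@[simp] theorem Tm.subst_id {σ : Ty} (t : Tm σ) : t.subst Sub.id = t := by
  induction t <;> simp_all [Tm.subst, Sub.id]

theorem Tm.subst_subst {σ : Ty} (t : Tm σ) (s s' : Sub) :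
    (t.subst s).subst s' = t.subst (s.comp s') := by
  induction t <;> simp_all [Tm.subst, Sub.comp]

theorem Sub.shift_comp_cons {σ : Ty} (t : Tm σ) (s : Sub) :
    (Sub.shift σ).comp (Sub.cons t s) = s := by
  funext τ n
  by_cases h : σ = τ
  · subst h; simp [Sub.comp, Tm.subst]
  · simp [Sub.comp, Sub.shift_of_ne h, Tm.subst, Sub.cons_of_ne h]

theorem Tm.lift_subst_cons {σ τ : Ty} (a : Tm τ) (t : Tm σ) (s : Sub) :
    (a.lift σ).subst (Sub.cons t s) = a.subst s := by
  rw [Tm.lift, Tm.subst_subst, Sub.shift_comp_cons]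

theorem Tm.lift_subst_under {σ τ : Ty} (a : Tm τ) (s : Sub) :
    (a.lift σ).subst (s.under σ) = (a.subst s).lift σ := by
  rw [Sub.under, Tm.lift_subst_cons, Tm.lift, Tm.subst_subst]; rfl

theorem Sub.under_id (σ : Ty) : Sub.id.under σ = Sub.id := by
  refine Sub.ext_cases σ ?_ (fun n => ?_) (fun τ n h => ?_)
  · simp [Sub.under, Sub.id]
  · simp [Sub.under, Sub.id, Tm.lift, Tm.subst]
  · simp [Sub.under, Sub.id, Tm.lift, Tm.subst, Sub.cons_of_ne h, Sub.shift_of_ne h]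

theorem Sub.under_comp (σ : Ty) (s s' : Sub) :
    (s.under σ).comp (s'.under σ) = (s.comp s').under σ := by
  refine Sub.ext_cases σ ?_ (fun n => ?_) (fun τ n h => ?_)
  · simp [Sub.under, Sub.comp, Tm.subst]
  · simp only [Sub.under, Sub.comp, Sub.cons_succ]
    exact Tm.lift_subst_under _ _
  · simp only [Sub.under, Sub.comp, Sub.cons_of_ne h]
    exact Tm.lift_subst_under _ _

@[simp] theorem Form.subst_id (A : Form) : A.subst Sub.id = A := by
  induction A <;> simp_all [Form.subst, Sub.under_id]

theorem Form.subst_subst (A : Form) (s s' : Sub) :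
    (A.subst s).subst s' = A.subst (s.comp s') := by
  induction A generalizing s s' <;> simp_all [Form.subst, Tm.subst_subst, Sub.under_comp]

theorem Sub.under_comp_cons {σ : Ty} (s s' : Sub) (t : Tm σ) :
    (s.under σ).comp (Sub.cons t s') = Sub.cons t (s.comp s') := by
  refine Sub.ext_cases σ ?_ (fun n => ?_) (fun τ n h => ?_)
  · simp [Sub.under, Sub.comp, Tm.subst]
  · simp only [Sub.under, Sub.comp, Sub.cons_succ]
    exact Tm.lift_subst_cons _ _ _
  · simp only [Sub.under, Sub.comp, Sub.cons_of_ne h]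
    exact Tm.lift_subst_cons _ _ _

theorem Sub.cons_comp {σ : Ty} (t : Tm σ) (s s' : Sub) :
    (Sub.cons t s).comp s' = Sub.cons (t.subst s') (s.comp s') := by
  refine Sub.ext_cases σ ?_ (fun n => ?_) (fun τ n h => ?_)
  · simp [Sub.comp]
  · simp [Sub.comp]
  · simp [Sub.comp, Sub.cons_of_ne h]

theorem Sub.comp_id (s : Sub) : s.comp Sub.id = s := by
  funext σ n; simp [Sub.comp]

theorem Sub.id_comp (s : Sub) : Sub.id.comp s = s := rfl

theorem Sub.shift_comp_under (σ : Ty) (s : Sub) :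
    (Sub.shift σ).comp (s.under σ) = s.comp (Sub.shift σ) := Sub.shift_comp_cons _ _

/-- Substituting below a quantifier and then instantiating it. -/
theorem Form.subst_under_inst {σ : Ty} (A : Form) (s : Sub) (t : Tm σ) :
    (A.subst (s.under σ)).inst t = A.subst (Sub.cons t s) := by
  rw [Form.inst, Form.subst_subst, Sub.under_comp_cons, Sub.comp_id]

theorem Form.inst_subst {σ : Ty} (A : Form) (s : Sub) (t : Tm σ) :
    (A.inst t).subst s = (A.subst (s.under σ)).inst (t.subst s) := by
  rw [Form.subst_under_inst, Form.inst, Form.subst_subst, Sub.cons_comp, Sub.id_comp]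

theorem Form.lift_subst_under {σ : Ty} (A : Form) (s : Sub) :
    (A.lift σ).subst (s.under σ) = (A.subst s).lift σ := by
  rw [Form.lift, Form.lift, Form.subst_subst, Form.subst_subst, Sub.shift_comp_under]

theorem Form.QF.subst {A : Form} (h : A.QF) (s : Sub) : (A.subst s).QF := by
  induction A with
  | eq => trivial
  | bot => trivial
  | imp A B ihA ihB => exact ⟨ihA h.1, ihB h.2⟩
  | all => exact h.elim

theorem Form.eqAt_subst {τ : Ty} (a b : Tm τ) (s : Sub) :
    (Form.eqAt τ a b).subst s = Form.eqAt τ (a.subst s) (b.subst s) := by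
  induction τ generalizing s with
  | nat => rfl
  | arr σ τ _ ih =>
    simp only [Form.eqAt, Form.subst, ih, Tm.subst, Tm.lift_subst_under]
    simp [Sub.under]

theorem Tm.lift_lift_comm {ρ σ τ : Ty} (h : ρ ≠ σ) (a : Tm τ) :
    (a.lift ρ).lift σ = (a.lift σ).lift ρ := by
  simp only [Tm.lift, Tm.subst_subst]
  congr 1
  funext τ n
  by_cases h₁ : ρ = τ
  · subst h₁
    simp [Sub.comp, Tm.subst, Sub.shift_of_ne h.symm]
  · by_cases h₂ : σ = τ
    · subst h₂
      simp [Sub.comp, Tm.subst, Sub.shift_of_ne h]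
    · simp [Sub.comp, Tm.subst, Sub.shift_of_ne h₁, Sub.shift_of_ne h₂]

/-- Variables are numbered separately for each type, so binders of different types do not interact.
The choice axiom needs this with `ρ = 2` and `σ = 1`: its functional is bound outside the function
argument, where the matrix knows only the latter. -/
theorem Sub.shift_comp_under_under {ρ σ : Ty} (h : ρ ≠ σ) (s : Sub) :
    (Sub.shift ρ).comp ((s.under ρ).under σ) = (s.under σ).comp (Sub.shift ρ) := by
  refine Sub.ext_cases ρ ?_ (fun n => ?_) (fun τ n hρ => ?_)
  · simp [Sub.comp, Tm.subst, Sub.under, Sub.cons_of_ne h.symm]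
    exact Tm.lift_lift_comm h _
  · simp [Sub.comp, Tm.subst, Sub.under, Sub.cons_of_ne h.symm]
    exact Tm.lift_lift_comm h _
  · by_cases hσ : σ = τ
    · subst hσ
      cases n with
      | zero => simp [Sub.comp, Tm.subst, Sub.under, Sub.shift_of_ne h]
      | succ n =>
        simp [Sub.comp, Tm.subst, Sub.under, Sub.shift_of_ne h, Sub.cons_of_ne h]
        exact Tm.lift_lift_comm h _
    · simp [Sub.comp, Tm.subst, Sub.under, Sub.shift_of_ne hρ, Sub.cons_of_ne hρ,
        Sub.cons_of_ne hσ]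
      exact Tm.lift_lift_comm h _

/-- The substitution instances of axioms of `RCA₀^ω` are axioms. -/
theorem RCA0ω_subst {A : Form} (h : RCA0ω A) (s : Sub) : RCA0ω (A.subst s) := by
  cases h with
  | refl a => exact .refl _
  | symm a b => exact .symm _ _
  | trans a b c => exact .trans _ _ _
  | succ_ne_zero a => exact .succ_ne_zero _
  | succ_inj a b => exact .succ_inj _ _
  | K_eq a b => rw [Form.eqAt_subst]; exact .K_eq _ _
  | S_eq a b c => rw [Form.eqAt_subst]; exact .S_eq _ _ _
  | R_zero y z => exact .R_zero _ _
  | R_succ x y z => exact .R_succ _ _ _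
  | ext f a b => simp only [Form.subst, Form.eqAt_subst]; exact .ext _ _ _
  | qf_ind A hA =>
    have := RCA0ω.qf_ind (A.subst (s.under .nat)) (hA.subst _)
    convert this using 1
    simp only [Form.subst, Form.inst_subst, Tm.subst, Form.subst_subst, Sub.cons_comp,
      Sub.under_comp_cons, Sub.shift_comp_under]
    simp [Sub.under]
  | qf_ac A hA =>
    have := RCA0ω.qf_ac (A.subst ((s.under .one).under .nat)) (hA.subst _)
    convert this using 1
    simp only [Form.subst, Form.ex, Form.neg, Form.subst_subst, Sub.cons_comp,
      Sub.under_comp_cons, Tm.subst]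
    congr 7
    exact Sub.shift_comp_under_under (by simp) s

/-! ## Derivations -/

theorem Deriv.weaken {T : Set Form} {Γ Γ' : List Form} {A : Form} (h : Deriv T Γ A)
    (hΓ : Γ ⊆ Γ') : Deriv T Γ' A := by
  induction h generalizing Γ' with
  | ax h => exact .ax h
  | hyp h => exact .hyp (hΓ h)
  | impI _ ih => exact .impI (ih (List.cons_subset_cons _ hΓ))
  | impE _ _ ih₁ ih₂ => exact .impE (ih₁ hΓ) (ih₂ hΓ)
  | raa _ ih => exact .raa (ih (List.cons_subset_cons _ hΓ))
  | allI _ ih => exact .allI (ih (List.map_subset _ hΓ))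
  | allE t _ ih => exact .allE t (ih hΓ)

/-- The axioms are schemes closed under substitution, so whole derivations can be substituted into.
The use is the renaming of a fresh variable to a bound one. -/
theorem Deriv.subst {T : Set Form} (hT : ∀ A ∈ T, ∀ s, A.subst s ∈ T) {Γ : List Form} {A : Form}
    (h : Deriv T Γ A) (s : Sub) : Deriv T (Γ.map (·.subst s)) (A.subst s) := by
  induction h generalizing s with
  | ax h => exact .ax (hT _ h s)
  | hyp h => exact .hyp (List.mem_map_of_mem h)
  | impI _ ih => exact .impI (ih s)
  | impE _ _ ih₁ ih₂ => exact .impE (ih₁ s) (ih₂ s)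
  | raa _ ih => exact .raa (ih s)
  | @allI Γ σ A _ ih =>
    refine .allI ?_
    have := ih (s.under σ)
    rw [List.map_map] at this ⊢
    have hΓ : Form.lift σ ∘ (fun B => B.subst s) = (fun B => B.subst (s.under σ)) ∘ Form.lift σ :=
      funext fun B => (Form.lift_subst_under B s).symm
    rwa [hΓ]
  | allE t _ ih =>
    rw [Form.inst_subst]
    exact .allE _ (ih s)

/-- Only finitely many variables matter for the result of a substitution in a term. -/
theorem Tm.exists_bound {σ : Ty} (t : Tm σ) : ∃ N, ∀ s s' : Sub,
    (∀ τ n, n < N → s τ n = s' τ n) → t.subst s = t.subst s' := by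
  induction t with
  | var σ n => exact ⟨n + 1, fun s s' h => h σ n n.lt_succ_self⟩
  | app f a ihf iha =>
    obtain ⟨N, hN⟩ := ihf
    obtain ⟨M, hM⟩ := iha
    refine ⟨max N M, fun s s' h => ?_⟩
    simp only [Tm.subst]
    rw [hN s s' fun τ n hn => h τ n (by omega), hM s s' fun τ n hn => h τ n (by omega)]
  | _ => exact ⟨0, fun _ _ _ => rfl⟩

/-- Only finitely many variables matter for the result of a substitution in a formula. -/
theorem Form.exists_bound (A : Form) : ∃ N, ∀ s s' : Sub,
    (∀ τ n, n < N → s τ n = s' τ n) → A.subst s = A.subst s' := by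
  induction A with
  | eq a b =>
    obtain ⟨N, hN⟩ := a.exists_bound
    obtain ⟨M, hM⟩ := b.exists_bound
    refine ⟨max N M, fun s s' h => ?_⟩
    simp only [Form.subst]
    rw [hN s s' fun τ n hn => h τ n (by omega), hM s s' fun τ n hn => h τ n (by omega)]
  | bot => exact ⟨0, fun _ _ _ => rfl⟩
  | imp A B ihA ihB =>
    obtain ⟨N, hN⟩ := ihA
    obtain ⟨M, hM⟩ := ihB
    refine ⟨max N M, fun s s' h => ?_⟩
    simp only [Form.subst]
    rw [hN s s' fun τ n hn => h τ n (by omega), hM s s' fun τ n hn => h τ n (by omega)]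
  | all σ A ih =>
    obtain ⟨N, hN⟩ := ih
    refine ⟨N, fun s s' h => ?_⟩
    simp only [Form.subst]
    rw [hN (s.under σ) (s'.under σ) fun τ n hn => ?_]
    by_cases hσ : σ = τ
    · subst hσ
      cases n with
      | zero => simp [Sub.under]
      | succ n => simp [Sub.under, h σ n (by omega)]
    · simp [Sub.under, Sub.cons_of_ne hσ, h τ n hn]

/-- A common bound for the variables of finitely many formulas. -/
theorem Form.exists_bound_list (Γ : List Form) : ∃ N, ∀ A ∈ Γ, ∀ s s' : Sub,
    (∀ τ n, n < N → s τ n = s' τ n) → A.subst s = A.subst s' := by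
  induction Γ with
  | nil => exact ⟨0, by simp⟩
  | cons A Γ ih =>
    obtain ⟨N, hN⟩ := ih
    obtain ⟨M, hM⟩ := A.exists_bound
    refine ⟨max N M, fun B hB s s' h => ?_⟩
    rcases List.mem_cons.1 hB with rfl | hB
    · exact hM s s' fun τ n hn => h τ n (by omega)
    · exact hN B hB s s' fun τ n hn => h τ n (by omega)

/-- Generalization over a variable that occurs neither in the hypotheses nor in the formula. -/
theorem Deriv.exists_fresh {T : Set Form} (hT : ∀ A ∈ T, ∀ s, A.subst s ∈ T) (Γ : List Form)
    (σ : Ty) (A : Form) : ∃ t : Tm σ, Deriv T Γ (A.inst t) → Deriv T Γ (.all σ A) := by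
  obtain ⟨N, hN⟩ := Form.exists_bound_list (A :: Γ)
  refine ⟨.var σ N, fun h => .allI ?_⟩
  -- This renaming turns the fresh variable `N` into the bound variable `0` and shifts all others.
  -- Below `N`, where all relevant variables lie, it agrees with the shift, so it weakens `Γ` and
  -- undoes the instantiation of `A`.
  let s : Sub := fun τ n => if τ = σ ∧ n = N then .var τ 0 else Sub.shift σ τ n
  have hs : ∀ τ n, n < N → s τ n = Sub.shift σ τ n := fun τ n hn => by
    simp [s, hn.ne]
  have hd := h.subst hT s
  have h1 : Γ.map (·.subst s) = Γ.map (Form.lift σ) :=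
    List.map_congr_left fun B hB => hN B (List.mem_cons_of_mem _ hB) _ _ hs
  have h2 : (A.inst (.var σ N)).subst s = A := by
    rw [Form.inst, Form.subst_subst, hN A List.mem_cons_self _ Sub.id, Form.subst_id]
    intro τ n hn
    by_cases hσ : σ = τ
    · subst hσ
      cases n with
      | zero => simp [Sub.comp, Tm.subst, s, Sub.id]
      | succ n => simp [Sub.comp, Sub.id, Tm.subst, hs σ n (by omega)]
    · simp [Sub.comp, Sub.cons_of_ne hσ, Sub.id, Tm.subst, hs τ n hn, Sub.shift_of_ne hσ]
  rwa [h1, h2] at hd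

/-! ## Countability of the language -/

/-- A numerical code of a type. -/
def Ty.code : Ty → ℕ
  | .nat => 0
  | .arr σ τ => Nat.pair σ.code τ.code + 1

theorem Ty.code_injective : Function.Injective Ty.code := by
  intro σ
  induction σ with
  | nat => intro τ h; cases τ <;> simp_all [Ty.code]
  | arr σ τ ihσ ihτ =>
    intro ρ h
    cases ρ with
    | nat => simp [Ty.code] at h
    | arr σ' τ' =>
      simp only [Ty.code, Nat.add_right_cancel_iff, Nat.pair_eq_pair] at h
      rw [ihσ h.1, ihτ h.2]

/-- A numerical code of a term. -/
def Tm.code : {σ : Ty} → Tm σ → ℕ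
  | _, .var σ n => Nat.pair 0 (Nat.pair σ.code n)
  | _, .zero => Nat.pair 1 0
  | _, .succ => Nat.pair 2 0
  | _, .K σ τ => Nat.pair 3 (Nat.pair σ.code τ.code)
  | _, .S ρ σ τ => Nat.pair 4 (Nat.pair ρ.code (Nat.pair σ.code τ.code))
  | _, .R => Nat.pair 5 0
  | _, .app f a => Nat.pair 6 (Nat.pair f.code a.code)

/-- The types are allowed to differ because the code of an application does not record its argument
type; that type is recovered from the code of the function part. -/
theorem Tm.code_injective {σ τ : Ty} (a : Tm σ) (b : Tm τ) (h : a.code = b.code) :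
    (⟨σ, a⟩ : Σ ρ, Tm ρ) = ⟨τ, b⟩ := by
  induction a generalizing τ with
  | app f a ihf iha =>
    cases b <;> simp [Tm.code, Nat.pair_eq_pair] at h
    have h1 := ihf _ h.1
    have h2 := iha _ h.2
    cases h1
    cases h2
    rfl
  | _ =>
    cases b <;> simp [Tm.code, Nat.pair_eq_pair, Ty.code_injective.eq_iff] at h
    all_goals
      first
        | rfl
        | (obtain ⟨rfl, rfl⟩ := h; rfl)
        | (obtain ⟨rfl, rfl, rfl⟩ := h; rfl)

/-- A numerical code of a formula. -/
def Form.code : Form → ℕ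
  | .eq a b => Nat.pair 0 (Nat.pair a.code b.code)
  | .bot => Nat.pair 1 0
  | .imp A B => Nat.pair 2 (Nat.pair A.code B.code)
  | .all σ A => Nat.pair 3 (Nat.pair σ.code A.code)

theorem Form.code_injective : Function.Injective Form.code := by
  intro A
  induction A with
  | eq a b =>
    intro B h
    cases B <;> simp [Form.code, Nat.pair_eq_pair] at h
    have h1 := Tm.code_injective _ _ h.1
    have h2 := Tm.code_injective _ _ h.2
    cases h1
    cases h2
    rfl
  | bot => intro B h; cases B <;> simp_all [Form.code, Nat.pair_eq_pair]
  | imp A A' ih ih' =>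
    intro B h
    cases B <;> simp [Form.code, Nat.pair_eq_pair] at h
    rw [ih h.1, ih' h.2]
  | all σ A ih =>
    intro B h
    cases B <;> simp [Form.code, Nat.pair_eq_pair, Ty.code_injective.eq_iff] at h
    rw [ih h.2, h.1]

/-! ## Henkin sets -/

variable {T : Set Form}

/-- A list of formulas is consistent over `T` if it does not derive `⊥`. -/
def Consistent (T : Set Form) (Γ : List Form) : Prop := ¬ Deriv T Γ .bot

theorem Deriv.botE {Γ : List Form} {A : Form} (h : Deriv T Γ .bot) : Deriv T Γ A :=
  .raa (h.weaken (List.subset_cons_self _ _))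

theorem Deriv.cut {Γ : List Form} {A B : Form} (h : Deriv T (A :: Γ) B) (hA : Deriv T Γ A) :
    Deriv T Γ B := .impE (.impI h) hA

/-- One step of the Henkin construction: a formula is decided, and a universal formula that is
rejected gets a counterexample. -/
theorem Consistent.exists_extension (hT : ∀ A ∈ T, ∀ s, A.subst s ∈ T) {Γ : List Form}
    (hΓ : Consistent T Γ) (A : Form) : ∃ Γ', Consistent T Γ' ∧ Γ ⊆ Γ' ∧
      (A ∈ Γ' ∨ A.neg ∈ Γ' ∧ ∀ σ B, A = .all σ B → ∃ t : Tm σ, (B.inst t).neg ∈ Γ') := by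
  by_cases hA : Consistent T (A :: Γ)
  · exact ⟨A :: Γ, hA, List.subset_cons_self _ _, .inl List.mem_cons_self⟩
  have hneg : Deriv T Γ A.neg := .impI (not_not.1 hA)
  have hcon : Consistent T (A.neg :: Γ) := fun h => hΓ (h.cut hneg)
  cases A with
  | all σ B =>
    -- The counterexample is a fresh variable: if adding the negated instance were inconsistent, the
    -- instance would be derivable, hence the universal formula by generalization, against its
    -- negation.
    obtain ⟨t, ht⟩ := Deriv.exists_fresh hT ((Form.all σ B).neg :: Γ) σ B
    refine ⟨(B.inst t).neg :: (Form.all σ B).neg :: Γ, fun h => hcon ?_, ?_, .inr ⟨by simp, ?_⟩⟩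
    · exact .impE (.hyp List.mem_cons_self) (ht (.raa h))
    · exact fun C hC => by simp [hC]
    · rintro σ' B' h
      cases h
      exact ⟨t, by simp⟩
  | _ => exact ⟨_, hcon, List.subset_cons_self _ _, .inr ⟨List.mem_cons_self, by simp⟩⟩

/-- A set of formulas that behaves like the set of the formulas true in some structure all of whose
elements are named by terms. -/
structure IsHenkin (T : Set Form) (Δ : Set Form) : Prop where
  deriv : ∀ Γ A, (∀ B ∈ Γ, B ∈ Δ) → Deriv T Γ A → A ∈ Δ
  bot : Form.bot ∉ Δ
  imp : ∀ A B, (A ⇛ B) ∈ Δ ↔ (A ∈ Δ → B ∈ Δ)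
  all : ∀ σ A, Form.all σ A ∈ Δ ↔ ∀ t : Tm σ, A.inst t ∈ Δ

/-- No Henkin constants are needed: every stage of the construction is a finite list, so variables
remain available as witnesses. -/
theorem Consistent.exists_henkin (hT : ∀ A ∈ T, ∀ s, A.subst s ∈ T) {Γ : List Form}
    (hΓ : Consistent T Γ) : ∃ Δ, IsHenkin T Δ ∧ ∀ A ∈ Γ, A ∈ Δ := by
  classical
  choose F hF using fun (Γ : {Γ // Consistent T Γ}) A => Consistent.exists_extension hT Γ.2 A
  have : Nonempty Form := ⟨.bot⟩
  -- An enumeration of all formulas; stage `n + 1` decides the formula `e n`, so `A` is decided at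
  -- stage `A.code + 1`.
  let e : ℕ → Form := Function.invFun Form.code
  have he : ∀ A, e A.code = A := Function.leftInverse_invFun Form.code_injective
  obtain ⟨G, hG0, hGs⟩ : ∃ G : ℕ → {Γ // Consistent T Γ},
      (G 0).1 = Γ ∧ ∀ n, (G (n + 1)).1 = F (G n) (e n) :=
    ⟨fun n => n.rec ⟨Γ, hΓ⟩ fun n Γ' => ⟨F Γ' (e n), (hF Γ' (e n)).1⟩, rfl, fun _ => rfl⟩
  have hstep : ∀ n, (G n).1 ⊆ (G (n + 1)).1 := fun n => by
    rw [hGs]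
    exact (hF (G n) (e n)).2.1
  have hmono : ∀ m n, m ≤ n → (G m).1 ⊆ (G n).1 := fun m n h => by
    induction h with
    | refl => exact List.Subset.refl _
    | step _ ih => exact fun A hA => hstep _ (ih hA)
  have hdec : ∀ A, A ∈ (G (A.code + 1)).1 ∨ A.neg ∈ (G (A.code + 1)).1 ∧
      ∀ σ B, A = .all σ B → ∃ t : Tm σ, (B.inst t).neg ∈ (G (A.code + 1)).1 := fun A => by
    have h := (hF (G A.code) (e A.code)).2.2
    rw [he] at h
    rwa [hGs, he]
  let Δ : Set Form := {A | ∃ n, A ∈ (G n).1}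
  have hmem : ∀ n A, A ∈ (G n).1 → A ∈ Δ := fun n _ h => ⟨n, h⟩
  have hfin : ∀ Γ' : List Form, (∀ B ∈ Γ', B ∈ Δ) → ∃ n, Γ' ⊆ (G n).1 := by
    intro Γ' h
    induction Γ' with
    | nil => exact ⟨0, by simp⟩
    | cons A Γ' ih =>
      obtain ⟨n, hn⟩ := ih fun B hB => h B (List.mem_cons_of_mem _ hB)
      obtain ⟨m, hm⟩ := h A List.mem_cons_self
      exact ⟨max m n, List.cons_subset.2
        ⟨hmono _ _ (le_max_left _ _) hm, fun B hB => hmono _ _ (le_max_right _ _) (hn hB)⟩⟩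
  have hcons : ∀ Γ' : List Form, (∀ B ∈ Γ', B ∈ Δ) → Consistent T Γ' := fun Γ' h hd => by
    obtain ⟨n, hn⟩ := hfin Γ' h
    exact (G n).2 (hd.weaken hn)
  -- If the negation of a derivable formula had been chosen, finitely many members of `Δ` would be
  -- inconsistent, and these all occur at one stage.
  have hded : ∀ Γ' A, (∀ B ∈ Γ', B ∈ Δ) → Deriv T Γ' A → A ∈ Δ := fun Γ' A h hd => by
    rcases hdec A with hA | ⟨hA, -⟩
    · exact hmem _ _ hA
    · refine (hcons (A.neg :: Γ') ?_ ?_).elim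
      · exact List.forall_mem_cons.2 ⟨hmem _ _ hA, h⟩
      · exact .impE (.hyp List.mem_cons_self) (hd.weaken (List.subset_cons_self _ _))
  have hbot : Form.bot ∉ Δ := fun h =>
    hcons [.bot] (by simpa using h) (.hyp List.mem_cons_self)
  have hneg : ∀ A, A ∉ Δ → A.neg ∈ Δ := fun A hA =>
    (hdec A).elim (fun h => (hA (hmem _ _ h)).elim) fun h => hmem _ _ h.1
  have hmp : ∀ A B, (A ⇛ B) ∈ Δ → A ∈ Δ → B ∈ Δ := fun A B h hA =>
    hded [A ⇛ B, A] B (by simp [h, hA])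
      (.impE (.hyp (A := A ⇛ B) (by simp)) (.hyp (by simp)))
  refine ⟨Δ, ⟨hded, hbot, fun A B => ⟨hmp A B, fun h => ?_⟩,
      fun σ A => ⟨fun h t => ?_, fun h => ?_⟩⟩,
    fun A hA => ⟨0, hG0 ▸ hA⟩⟩
  · by_cases hA : A ∈ Δ
    · exact hded [B] _ (by simpa using h hA) (.impI (.hyp (by simp)))
    · exact hded [A.neg] _ (by simpa using hneg A hA)
        (.impI (Deriv.botE (.impE (.hyp (A := A.neg) (by simp)) (.hyp (by simp)))))
  · exact hded [.all σ A] _ (by simpa using h) (.allE t (.hyp (by simp)))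
  · rcases hdec (.all σ A) with hA | ⟨-, hA⟩
    · exact hmem _ _ hA
    · obtain ⟨t, ht⟩ := hA σ A rfl
      exact (hbot (hmp _ _ (hmem _ _ ht) (h t))).elim

/-! ## Interpretations -/

/-- An interpretation of the language in which equality at type `0` is true equality, and in which
functionals are determined by their values. -/
structure Interp where
  Carrier : Ty → Type
  app : {σ τ : Ty} → Carrier (σ ⇾ τ) → Carrier σ → Carrier τ
  zero : Carrier .nat
  succ : Carrier (.nat ⇾ .nat)
  K : (σ τ : Ty) → Carrier (σ ⇾ τ ⇾ σ)
  S : (ρ σ τ : Ty) → Carrier ((ρ ⇾ σ ⇾ τ) ⇾ (ρ ⇾ σ) ⇾ ρ ⇾ τ)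
  R : Carrier (.nat ⇾ .nat ⇾ (.nat ⇾ .nat ⇾ .nat) ⇾ .nat)
  app_ext : ∀ {σ τ : Ty} (f g : Carrier (σ ⇾ τ)), (∀ z, app f z = app g z) → f = g

namespace Interp

variable (𝔐 : Interp)

/-- Valuations of the variables. -/
abbrev Val : Type := (σ : Ty) → ℕ → 𝔐.Carrier σ

variable {𝔐}

/-- Adding a value for a new variable `0` of type `σ`. -/
def Val.cons {σ : Ty} (x : 𝔐.Carrier σ) (v : 𝔐.Val) : 𝔐.Val := fun τ n =>
  if h : σ = τ then
    match n with
    | 0 => h ▸ x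
    | n + 1 => v τ n
  else v τ n

@[simp] theorem Val.cons_zero {σ : Ty} (x : 𝔐.Carrier σ) (v : 𝔐.Val) : v.cons x σ 0 = x := by
  simp [Val.cons]

@[simp] theorem Val.cons_succ {σ : Ty} (x : 𝔐.Carrier σ) (v : 𝔐.Val) (n : ℕ) :
    v.cons x σ (n + 1) = v σ n := by
  simp [Val.cons]

@[simp] theorem Val.cons_of_ne {σ τ : Ty} (h : σ ≠ τ) (x : 𝔐.Carrier σ) (v : 𝔐.Val) (n : ℕ) :
    v.cons x τ n = v τ n := by
  simp [Val.cons, h]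

/-- The value of a term. -/
def eval (v : 𝔐.Val) : {σ : Ty} → Tm σ → 𝔐.Carrier σ
  | _, .var σ n => v σ n
  | _, .zero => 𝔐.zero
  | _, .succ => 𝔐.succ
  | _, .K σ τ => 𝔐.K σ τ
  | _, .S ρ σ τ => 𝔐.S ρ σ τ
  | _, .R => 𝔐.R
  | _, .app f a => 𝔐.app (eval v f) (eval v a)

/-- Satisfaction of a formula. -/
def Sat : 𝔐.Val → Form → Prop
  | v, .eq a b => eval v a = eval v b
  | _, .bot => False
  | v, .imp A B => Sat v A → Sat v B
  | v, .all σ A => ∀ x : 𝔐.Carrier σ, Sat (v.cons x) A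

theorem eval_subst (v : 𝔐.Val) {σ : Ty} (t : Tm σ) (s : Sub) :
    eval v (t.subst s) = eval (fun σ n => eval v (s σ n)) t := by
  induction t <;> simp_all [eval, Tm.subst]

@[simp] theorem eval_lift (v : 𝔐.Val) {σ τ : Ty} (x : 𝔐.Carrier σ) (t : Tm τ) :
    eval (v.cons x) (t.lift σ) = eval v t := by
  rw [Tm.lift, eval_subst]
  congr 1
  funext ρ n
  by_cases h : σ = ρ
  · subst h; simp [eval]
  · simp [Sub.shift_of_ne h, eval, h]

theorem eval_cons (v : 𝔐.Val) {σ : Ty} (t : Tm σ) (s : Sub) :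
    (fun ρ n => eval v (Sub.cons t s ρ n)) = Val.cons (eval v t) (fun ρ n => eval v (s ρ n)) := by
  funext ρ n
  by_cases h : σ = ρ
  · subst h
    cases n <;> simp
  · simp [Sub.cons_of_ne h, h]

theorem eval_shift (v : 𝔐.Val) {σ : Ty} (x : 𝔐.Carrier σ) :
    (fun ρ n => eval (v.cons x) (Sub.shift σ ρ n)) = v := by
  funext ρ n
  by_cases h : σ = ρ
  · subst h; simp [eval]
  · simp [Sub.shift_of_ne h, eval, h]

theorem sat_subst (v : 𝔐.Val) (A : Form) (s : Sub) :
    Sat v (A.subst s) ↔ Sat (fun σ n => eval v (s σ n)) A := by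
  induction A generalizing v s with
  | eq a b => simp [Sat, Form.subst, eval_subst]
  | bot => rfl
  | imp A B ihA ihB => simp [Sat, Form.subst, ihA, ihB]
  | all σ A ih =>
    simp only [Sat, Form.subst, ih, Sub.under, eval_cons, eval_lift]
    simp [eval]

/-- By induction on the type, `app_ext` turns the defined extensional equality into true equality.
Axioms about `eqAt` can therefore be used in models as plain equations. -/
theorem sat_eqAt (v : 𝔐.Val) {τ : Ty} (a b : Tm τ) :
    Sat v (Form.eqAt τ a b) ↔ eval v a = eval v b := by
  induction τ generalizing v with
  | nat => rfl
  | arr σ τ _ ih =>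
    simp only [Form.eqAt, Sat, ih, eval, eval_lift, Val.cons_zero]
    exact ⟨𝔐.app_ext _ _, fun h z => by rw [h]⟩

@[simp] theorem sat_eq (v : 𝔐.Val) (a b : Tm .nat) : Sat v (.eq a b) ↔ eval v a = eval v b := .rfl

@[simp] theorem sat_imp (v : 𝔐.Val) (A B : Form) : Sat v (A ⇛ B) ↔ (Sat v A → Sat v B) := .rfl

@[simp] theorem sat_all (v : 𝔐.Val) (σ : Ty) (A : Form) :
    Sat v (.all σ A) ↔ ∀ x : 𝔐.Carrier σ, Sat (v.cons x) A := .rfl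

@[simp] theorem sat_neg (v : 𝔐.Val) (A : Form) : Sat v A.neg ↔ ¬ Sat v A := .rfl

@[simp] theorem sat_and (v : 𝔐.Val) (A B : Form) : Sat v (A.and B) ↔ Sat v A ∧ Sat v B := by
  simp [Form.and]

@[simp] theorem sat_or (v : 𝔐.Val) (A B : Form) : Sat v (A.or B) ↔ Sat v A ∨ Sat v B := by
  simp [Form.or, or_iff_not_imp_left]

@[simp] theorem sat_ex (v : 𝔐.Val) (σ : Ty) (A : Form) :
    Sat v (.ex σ A) ↔ ∃ x : 𝔐.Carrier σ, Sat (v.cons x) A := by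
  simp [Form.ex]

end Interp

/-- Models of `RCA₀^ω` (with extensional equality as true equality). -/
structure Model extends Interp where
  sound : ∀ A ∈ RCA0ω, ∀ v : toInterp.Val, Interp.Sat v A

/-! ## Completeness -/

namespace IsHenkin

variable {Δ : Set Form}

theorem ax (hΔ : IsHenkin RCA0ω Δ) {A : Form} (h : RCA0ω A) : A ∈ Δ :=
  hΔ.deriv [] A (by simp) (.ax h)

theorem eqAt_inst (hΔ : IsHenkin RCA0ω Δ) {σ τ : Ty} (f g : Tm (σ ⇾ τ)) :
    Form.eqAt (σ ⇾ τ) f g ∈ Δ ↔ ∀ t : Tm σ, Form.eqAt τ (f ⬝ t) (g ⬝ t) ∈ Δ := by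
  rw [Form.eqAt, hΔ.all]
  simp [Form.inst, Form.eqAt_subst, Tm.subst, Tm.lift_subst_cons]

theorem eqAt_refl (hΔ : IsHenkin RCA0ω Δ) {σ : Ty} (a : Tm σ) : Form.eqAt σ a a ∈ Δ := by
  induction σ with
  | nat => exact hΔ.ax (.refl a)
  | arr σ τ _ ih => exact (hΔ.eqAt_inst _ _).2 fun t => ih _

theorem eqAt_symm (hΔ : IsHenkin RCA0ω Δ) {σ : Ty} {a b : Tm σ}
    (h : Form.eqAt σ a b ∈ Δ) : Form.eqAt σ b a ∈ Δ := by
  induction σ with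
  | nat => exact (hΔ.imp _ _).1 (hΔ.ax (.symm a b)) h
  | arr σ τ _ ih => exact (hΔ.eqAt_inst _ _).2 fun t => ih ((hΔ.eqAt_inst _ _).1 h t)

theorem eqAt_trans (hΔ : IsHenkin RCA0ω Δ) {σ : Ty} {a b c : Tm σ}
    (h : Form.eqAt σ a b ∈ Δ) (h' : Form.eqAt σ b c ∈ Δ) : Form.eqAt σ a c ∈ Δ := by
  induction σ with
  | nat => exact (hΔ.imp _ _).1 ((hΔ.imp _ _).1 (hΔ.ax (.trans a b c)) h) h'
  | arr σ τ _ ih =>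
    exact (hΔ.eqAt_inst _ _).2 fun t =>
      ih ((hΔ.eqAt_inst _ _).1 h t) ((hΔ.eqAt_inst _ _).1 h' t)

/-- Provable equality in a Henkin set. -/
def setoid (hΔ : IsHenkin RCA0ω Δ) (σ : Ty) : Setoid (Tm σ) where
  r a b := Form.eqAt σ a b ∈ Δ
  iseqv := ⟨hΔ.eqAt_refl, hΔ.eqAt_symm, hΔ.eqAt_trans⟩

/-- The term interpretation of a Henkin set. -/
def interp (hΔ : IsHenkin RCA0ω Δ) : Interp where
  Carrier σ := Quotient (hΔ.setoid σ)
  -- Application respects equality in the argument by the extensionality axiom, and in the function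
  -- because equality at an arrow type is pointwise.
  app := Quotient.map₂ Tm.app fun f _ hf _ b ha =>
    hΔ.eqAt_trans ((hΔ.imp _ _).1 (hΔ.ax (.ext f _ _)) ha) ((hΔ.eqAt_inst _ _).1 hf b)
  zero := Quotient.mk _ .zero
  succ := Quotient.mk _ .succ
  K σ τ := Quotient.mk _ (.K σ τ)
  S ρ σ τ := Quotient.mk _ (.S ρ σ τ)
  R := Quotient.mk _ .R
  app_ext f g := Quotient.inductionOn₂ f g fun _ _ h =>
    Quotient.sound ((hΔ.eqAt_inst _ _).2 fun t => Quotient.exact (h (Quotient.mk _ t)))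

/-- The element of the term interpretation that is named by a term. -/
def elem (hΔ : IsHenkin RCA0ω Δ) {σ : Ty} (t : Tm σ) : hΔ.interp.Carrier σ :=
  Quotient.mk (hΔ.setoid σ) t

theorem elem_surjective (hΔ : IsHenkin RCA0ω Δ) (σ : Ty) : Function.Surjective (hΔ.elem (σ := σ)) :=
  Quotient.exists_rep

theorem elem_eq_elem (hΔ : IsHenkin RCA0ω Δ) {σ : Ty} {a b : Tm σ} :
    hΔ.elem a = hΔ.elem b ↔ Form.eqAt σ a b ∈ Δ := Quotient.eq

/-- The valuation given by a substitution. -/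
def val (hΔ : IsHenkin RCA0ω Δ) (s : Sub) : hΔ.interp.Val := fun σ n => hΔ.elem (s σ n)

theorem eval_val (hΔ : IsHenkin RCA0ω Δ) (s : Sub) {σ : Ty} (t : Tm σ) :
    Interp.eval (hΔ.val s) t = hΔ.elem (t.subst s) := by
  induction t with
  | app f a ihf iha => rw [Interp.eval, ihf, iha]; rfl
  | _ => rfl

theorem val_cons (hΔ : IsHenkin RCA0ω Δ) {σ : Ty} (t : Tm σ) (s : Sub) :
    (hΔ.val s).cons (hΔ.elem t) = hΔ.val (Sub.cons t s) := by
  funext τ n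
  by_cases h : σ = τ
  · subst h
    cases n <;> simp [val]
  · simp [val, h, Sub.cons_of_ne h]

/-- The truth lemma. In the quantifier case, every element of the term model is named by a term, so
quantifying over elements amounts to the instance condition `IsHenkin.all`. -/
theorem sat_val (hΔ : IsHenkin RCA0ω Δ) (s : Sub) (A : Form) :
    Interp.Sat (hΔ.val s) A ↔ A.subst s ∈ Δ := by
  induction A generalizing s with
  | eq a b =>
    rw [Interp.sat_eq, eval_val, eval_val]
    exact hΔ.elem_eq_elem
  | bot => exact iff_of_false id hΔ.bot
  | imp A B ihA ihB => rw [Interp.sat_imp, ihA, ihB, Form.subst, hΔ.imp]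
  | all σ A ih =>
    rw [Interp.sat_all, Form.subst, hΔ.all, (hΔ.elem_surjective σ).forall]
    simp only [Form.subst_under_inst, ← ih, val_cons]

/-- The term model of a Henkin set. -/
def model (hΔ : IsHenkin RCA0ω Δ) : Model where
  toInterp := hΔ.interp
  sound A hA v := by
    -- Naming the values of `v` by terms turns the valuation into a substitution, and substitution
    -- instances of axioms are axioms.
    choose s hs using fun σ n => hΔ.elem_surjective σ (v σ n)
    obtain rfl : hΔ.val s = v := by
      funext σ n
      exact hs σ n
    rw [sat_val]
    exact hΔ.ax (RCA0ω_subst hA _)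

end IsHenkin

/-- Completeness: what holds in all models of `RCA₀^ω` is provable in `RCA₀^ω`. -/
theorem proves_of_sat {A : Form} (h : ∀ (𝔐 : Model) (v : 𝔐.Val), Interp.Sat v A) :
    Proves RCA0ω A := by
  by_contra hA
  have hcon : Consistent RCA0ω [A.neg] := fun hd => hA (.raa hd)
  obtain ⟨Δ, hΔ, hmem⟩ := hcon.exists_henkin fun B (hB : RCA0ω B) s => RCA0ω_subst hB s
  have hneg := (hΔ.sat_val Sub.id A.neg).2 (by simpa using hmem)
  exact hneg (h hΔ.model _)

/-! ## Bracket abstraction -/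

/-- Abstraction over the variable `0` of type `σ`. -/
def Tm.lam (σ : Ty) : {τ : Ty} → Tm τ → Tm (σ ⇾ τ)
  | _, .var τ n =>
    if h : σ = τ then
      match n with
      | 0 => h ▸ (.S σ (σ ⇾ σ) σ ⬝ .K σ (σ ⇾ σ) ⬝ .K σ σ)
      | n + 1 => .K τ σ ⬝ .var τ n
    else .K τ σ ⬝ .var τ n
  | _, .zero => .K _ σ ⬝ .zero
  | _, .succ => .K _ σ ⬝ .succ
  | _, .K ρ τ => .K _ σ ⬝ .K ρ τ
  | _, .S ρ ρ' τ => .K _ σ ⬝ .S ρ ρ' τ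
  | _, .R => .K _ σ ⬝ .R
  | _, .app f a => .S σ _ _ ⬝ f.lam σ ⬝ a.lam σ

/-- All variables of type `τ` in the term have index less than `k τ`. -/
def Tm.VarsBelow (k : Ty → ℕ) : {σ : Ty} → Tm σ → Prop
  | _, .var σ n => n < k σ
  | _, .app f a => f.VarsBelow k ∧ a.VarsBelow k
  | _, _ => True

/-- Closedness cannot be checked directly through abstractions, whose bodies contain variables.
Index bounds can: each abstraction lowers the bound for one type by one, down to `0` for the
finished term. -/
theorem Tm.VarsBelow.lam {k : Ty → ℕ} {σ τ : Ty} {t : Tm τ}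
    (h : t.VarsBelow fun ρ => if ρ = σ then k ρ + 1 else k ρ) : (t.lam σ).VarsBelow k := by
  induction t with
  | var τ n =>
    by_cases hσ : σ = τ
    · subst hσ
      cases n with
      | zero => simp [Tm.lam, Tm.VarsBelow]
      | succ n => simpa [Tm.lam, Tm.VarsBelow] using h
    · simpa [Tm.lam, hσ, Ne.symm hσ, Tm.VarsBelow] using h
  | app f a ihf iha => exact ⟨⟨trivial, ihf h.1⟩, iha h.2⟩
  | _ => exact ⟨trivial, trivial⟩

theorem Tm.VarsBelow.closed {σ : Ty} {t : Tm σ} (h : t.VarsBelow fun _ => 0) : t.Closed := by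
  induction t with
  | var σ n => exact absurd h (Nat.not_lt_zero n)
  | app f a ihf iha => exact ⟨ihf h.1, iha h.2⟩
  | _ => trivial

infixl:75 " ⊙ " => Interp.app _

/-! ## The axioms in models -/

namespace Model

variable {𝔐 : Model}

/-- Every type of a model has an element. -/
theorem nonempty_carrier (𝔐 : Model) (σ : Ty) : Nonempty (𝔐.Carrier σ) := by
  induction σ with
  | nat => exact ⟨𝔐.zero⟩
  | arr σ τ _ ih => exact ih.map fun y => 𝔐.K τ σ ⊙ y

/-- The axioms speak of terms; to apply them to arbitrary elements, these are made values of
variables. The indices `0`, `1`, `2` are distinct so that the types may coincide. -/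
theorem exists_val {ρ σ τ : Ty} (a : 𝔐.Carrier ρ) (b : 𝔐.Carrier σ) (c : 𝔐.Carrier τ) :
    ∃ v : 𝔐.Val, v ρ 0 = a ∧ v σ 1 = b ∧ v τ 2 = c := by
  classical
  let single {σ : Ty} (a : 𝔐.Carrier σ) (τ : Ty) : 𝔐.Carrier τ :=
    if h : σ = τ then h ▸ a else (𝔐.nonempty_carrier τ).some
  refine ⟨fun υ n => match n with
    | 0 => single a υ
    | 1 => single b υ
    | _ => single c υ, ?_, ?_, ?_⟩ <;> simp [single]

theorem K_app {σ τ : Ty} (a : 𝔐.Carrier σ) (b : 𝔐.Carrier τ) : 𝔐.K σ τ ⊙ a ⊙ b = a := by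
  obtain ⟨v, rfl, rfl, -⟩ := exists_val a b b
  exact (Interp.sat_eqAt _ _ _).1 (𝔐.sound _ (.K_eq (.var σ 0) (.var τ 1)) v)

theorem S_app {ρ σ τ : Ty} (a : 𝔐.Carrier (ρ ⇾ σ ⇾ τ)) (b : 𝔐.Carrier (ρ ⇾ σ))
    (c : 𝔐.Carrier ρ) : 𝔐.S ρ σ τ ⊙ a ⊙ b ⊙ c = a ⊙ c ⊙ (b ⊙ c) := by
  obtain ⟨v, rfl, rfl, rfl⟩ := exists_val a b c
  exact (Interp.sat_eqAt _ _ _).1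
    (𝔐.sound _ (.S_eq (.var (ρ ⇾ σ ⇾ τ) 0) (.var (ρ ⇾ σ) 1) (.var ρ 2)) v)

theorem R_zero (y : 𝔐.Carrier .nat) (z : 𝔐.Carrier (.nat ⇾ .nat ⇾ .nat)) :
    𝔐.R ⊙ 𝔐.zero ⊙ y ⊙ z = y := by
  obtain ⟨v, rfl, rfl, -⟩ := exists_val y z y
  exact 𝔐.sound _ (.R_zero (.var _ 0) (.var _ 1)) v

theorem R_succ (x y : 𝔐.Carrier .nat) (z : 𝔐.Carrier (.nat ⇾ .nat ⇾ .nat)) :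
    𝔐.R ⊙ (𝔐.succ ⊙ x) ⊙ y ⊙ z = z ⊙ (𝔐.R ⊙ x ⊙ y ⊙ z) ⊙ x := by
  obtain ⟨v, rfl, rfl, rfl⟩ := exists_val x y z
  exact 𝔐.sound _ (.R_succ (.var _ 0) (.var _ 1) (.var _ 2)) v

theorem succ_ne_zero (x : 𝔐.Carrier .nat) : 𝔐.succ ⊙ x ≠ 𝔐.zero := by
  obtain ⟨v, rfl, -, -⟩ := exists_val x x x
  exact 𝔐.sound _ (.succ_ne_zero (.var _ 0)) v

theorem eval_lam (v : 𝔐.Val) {σ τ : Ty} (t : Tm τ) (x : 𝔐.Carrier σ) :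
    Interp.eval v (t.lam σ) ⊙ x = Interp.eval (v.cons x) t := by
  induction t with
  | var τ n =>
    by_cases h : σ = τ
    · subst h
      cases n <;> simp [Tm.lam, Interp.eval, K_app, S_app]
    · simp [Tm.lam, h, Interp.eval, K_app]
  | app f a ihf iha => simp only [Tm.lam, Interp.eval, S_app, ihf, iha]
  | _ => simp [Tm.lam, Interp.eval, K_app]

/-! ## Internal functions and quantifier-free predicates -/

/-- The function is given by an element of the model. -/
@[fun_prop]
def Internal {σ τ : Ty} (f : 𝔐.Carrier σ → 𝔐.Carrier τ) : Prop :=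
  ∃ F : 𝔐.Carrier (σ ⇾ τ), ∀ x, F ⊙ x = f x

@[fun_prop]
theorem internal_id {σ : Ty} : Internal fun x : 𝔐.Carrier σ => x :=
  ⟨𝔐.S σ (σ ⇾ σ) σ ⊙ 𝔐.K σ (σ ⇾ σ) ⊙ 𝔐.K σ σ, fun x => by rw [S_app, K_app]⟩

@[fun_prop]
theorem internal_const {σ τ : Ty} (c : 𝔐.Carrier τ) : Internal fun _ : 𝔐.Carrier σ => c :=
  ⟨𝔐.K τ σ ⊙ c, fun x => K_app c x⟩

@[fun_prop]
theorem Internal.app {ρ σ τ : Ty} {f : 𝔐.Carrier ρ → 𝔐.Carrier (σ ⇾ τ)}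
    {g : 𝔐.Carrier ρ → 𝔐.Carrier σ} (hf : Internal f) (hg : Internal g) :
    Internal fun x => f x ⊙ g x := by
  obtain ⟨F, hF⟩ := hf
  obtain ⟨G, hG⟩ := hg
  exact ⟨𝔐.S ρ σ τ ⊙ F ⊙ G, fun x => by rw [S_app, hF, hG]⟩

/-- The predicate is given by a quantifier-free formula with parameters. -/
def QFDef (P : 𝔐.Carrier .nat → Prop) : Prop :=
  ∃ (A : Form) (v : 𝔐.Val), A.QF ∧ ∀ x, P x ↔ Interp.Sat (v.cons x) A

theorem qfDef_eq {f g : 𝔐.Carrier .nat → 𝔐.Carrier .nat} (hf : Internal f) (hg : Internal g) :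
    QFDef fun x => f x = g x := by
  obtain ⟨F, hF⟩ := hf
  obtain ⟨G, hG⟩ := hg
  obtain ⟨v, rfl, rfl, -⟩ := exists_val F G F
  refine ⟨.eq (.var .one 0 ⬝ .var .nat 0) (.var .one 1 ⬝ .var .nat 0), v, trivial, fun x => ?_⟩
  simp [Interp.eval, hF, hG]

theorem qfDef_false : QFDef fun _ : 𝔐.Carrier .nat => False :=
  ⟨.bot, fun σ _ => (𝔐.nonempty_carrier σ).some, trivial, fun _ => .rfl⟩

theorem QFDef.imp {P Q : 𝔐.Carrier .nat → Prop} (hP : QFDef P) (hQ : QFDef Q) :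
    QFDef fun x => P x → Q x := by
  obtain ⟨A, v, hA, hPA⟩ := hP
  obtain ⟨B, w, hB, hQB⟩ := hQ
  -- The parameters of the two formulas are kept apart by moving them to even and odd indices, while
  -- the distinguished variable `0` stays fixed.
  let s (i : ℕ) : Sub := (Sub.under .nat fun σ n => .var σ (2 * n + i))
  let u : 𝔐.Val := fun σ n => if n % 2 = 0 then v σ (n / 2) else w σ (n / 2)
  refine ⟨A.subst (s 0) ⇛ B.subst (s 1), u, ⟨hA.subst _, hB.subst _⟩, fun x => ?_⟩
  have h0 : (fun σ n => Interp.eval (u.cons x) (s 0 σ n)) = v.cons x := by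
    simp only [s, Sub.under, Interp.eval_cons, Interp.eval_lift]
    simp [Interp.eval, u]
  have h1 : (fun σ n => Interp.eval (u.cons x) (s 1 σ n)) = w.cons x := by
    simp only [s, Sub.under, Interp.eval_cons, Interp.eval_lift]
    have (n : ℕ) : (2 * n + 1) / 2 = n := by omega
    simp [Interp.eval, u, this]
  simp only [Interp.sat_imp, Interp.sat_subst, h0, h1, hPA, hQB]

theorem QFDef.not {P : 𝔐.Carrier .nat → Prop} (hP : QFDef P) : QFDef fun x => ¬ P x :=
  hP.imp qfDef_false

theorem QFDef.or {P Q : 𝔐.Carrier .nat → Prop} (hP : QFDef P) (hQ : QFDef Q) :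
    QFDef fun x => P x ∨ Q x := by
  simpa only [or_iff_not_imp_left] using hP.not.imp hQ

theorem induction {P : 𝔐.Carrier .nat → Prop} (hP : QFDef P) (h0 : P 𝔐.zero)
    (hs : ∀ x, P x → P (𝔐.succ ⊙ x)) (x : 𝔐.Carrier .nat) : P x := by
  obtain ⟨A, v, hA, hPA⟩ := hP
  have h := 𝔐.sound _ (.qf_ind A hA) v
  simp only [Interp.sat_imp, Interp.sat_all, Form.inst, Interp.sat_subst, Interp.eval_cons,
    Interp.eval_shift] at h
  simp only [hPA] at h0 hs ⊢
  refine h h0 (fun x hx => ?_) x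
  simpa [Interp.eval] using hs x hx

/-! ## Arithmetic in models -/

instance : Zero (𝔐.Carrier .nat) := ⟨𝔐.zero⟩

instance : One (𝔐.Carrier .nat) := ⟨𝔐.succ ⊙ 𝔐.zero⟩

instance : Add (𝔐.Carrier .nat) := ⟨fun a b =>
  𝔐.R ⊙ b ⊙ a ⊙ (𝔐.S .nat .nat (.nat ⇾ .nat) ⊙
    (𝔐.K (.nat ⇾ .nat ⇾ .nat) .nat ⊙ 𝔐.K .nat .nat) ⊙ 𝔐.succ)⟩

theorem add_def (a b : 𝔐.Carrier .nat) : a + b = 𝔐.R ⊙ b ⊙ a ⊙ (𝔐.S .nat .nat (.nat ⇾ .nat) ⊙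
    (𝔐.K (.nat ⇾ .nat ⇾ .nat) .nat ⊙ 𝔐.K .nat .nat) ⊙ 𝔐.succ) := rfl

instance : Mul (𝔐.Carrier .nat) := ⟨fun a b =>
  𝔐.R ⊙ b ⊙ 𝔐.zero ⊙ (𝔐.S .nat .nat (.nat ⇾ .nat) ⊙
    (𝔐.K (.nat ⇾ .nat ⇾ .nat) .nat ⊙ 𝔐.K .nat .nat) ⊙
      (𝔐.S .nat (.nat ⇾ .nat ⇾ .nat) .nat ⊙ (𝔐.R ⊙ a) ⊙
        (𝔐.K (.nat ⇾ .nat ⇾ .nat) .nat ⊙ (𝔐.S .nat .nat (.nat ⇾ .nat) ⊙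
          (𝔐.K (.nat ⇾ .nat ⇾ .nat) .nat ⊙ 𝔐.K .nat .nat) ⊙ 𝔐.succ))))⟩

theorem mul_def (a b : 𝔐.Carrier .nat) : a * b =
  𝔐.R ⊙ b ⊙ 𝔐.zero ⊙ (𝔐.S .nat .nat (.nat ⇾ .nat) ⊙
    (𝔐.K (.nat ⇾ .nat ⇾ .nat) .nat ⊙ 𝔐.K .nat .nat) ⊙
      (𝔐.S .nat (.nat ⇾ .nat ⇾ .nat) .nat ⊙ (𝔐.R ⊙ a) ⊙
        (𝔐.K (.nat ⇾ .nat ⇾ .nat) .nat ⊙ (𝔐.S .nat .nat (.nat ⇾ .nat) ⊙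
          (𝔐.K (.nat ⇾ .nat ⇾ .nat) .nat ⊙ 𝔐.K .nat .nat) ⊙ 𝔐.succ)))) := rfl

/-- The predecessor function. -/
def pred (𝔐 : Model) : 𝔐.Carrier (.nat ⇾ .nat) :=
  𝔐.S .nat (.nat ⇾ .nat ⇾ .nat) .nat ⊙
    (𝔐.S .nat .nat ((.nat ⇾ .nat ⇾ .nat) ⇾ .nat) ⊙ 𝔐.R ⊙ (𝔐.K .nat .nat ⊙ 𝔐.zero)) ⊙
    (𝔐.K (.nat ⇾ .nat ⇾ .nat) .nat ⊙ (𝔐.K (.nat ⇾ .nat) .nat ⊙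
      (𝔐.S .nat (.nat ⇾ .nat) .nat ⊙ 𝔐.K .nat (.nat ⇾ .nat) ⊙ 𝔐.K .nat .nat)))

instance : _root_.Sub (𝔐.Carrier .nat) := ⟨fun a b =>
  𝔐.R ⊙ b ⊙ a ⊙ (𝔐.S .nat .nat (.nat ⇾ .nat) ⊙
    (𝔐.K (.nat ⇾ .nat ⇾ .nat) .nat ⊙ 𝔐.K .nat .nat) ⊙ 𝔐.pred)⟩

theorem sub_def (a b : 𝔐.Carrier .nat) : a - b = 𝔐.R ⊙ b ⊙ a ⊙ (𝔐.S .nat .nat (.nat ⇾ .nat) ⊙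
    (𝔐.K (.nat ⇾ .nat ⇾ .nat) .nat ⊙ 𝔐.K .nat .nat) ⊙ 𝔐.pred) := rfl

theorem zero_def : 𝔐.zero = 0 := rfl

@[simp] theorem eval_zero (v : 𝔐.Val) : Interp.eval v .zero = 0 := rfl

@[simp] theorem eval_one (v : 𝔐.Val) : Interp.eval v Tm.one = 1 := rfl

@[simp] theorem eval_add (v : 𝔐.Val) (a b : Tm .nat) :
    Interp.eval v (Tm.add a b) = Interp.eval v a + Interp.eval v b := rfl

@[simp] theorem eval_sub (v : 𝔐.Val) (a b : Tm .nat) :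
    Interp.eval v (Tm.sub a b) = Interp.eval v a - Interp.eval v b := rfl

@[simp] theorem eval_pred (v : 𝔐.Val) : Interp.eval v Tm.pred = 𝔐.pred := rfl

@[fun_prop]
theorem Internal.add {σ : Ty} {f g : 𝔐.Carrier σ → 𝔐.Carrier .nat} (hf : Internal f)
    (hg : Internal g) : Internal fun x => f x + g x := by
  simp only [add_def]
  exact (((internal_const _).app hg).app hf).app (internal_const _)

@[fun_prop]
theorem Internal.mul {σ : Ty} {f g : 𝔐.Carrier σ → 𝔐.Carrier .nat} (hf : Internal f)
    (hg : Internal g) : Internal fun x => f x * g x := by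
  simp only [mul_def]
  exact (((internal_const _).app hg).app (internal_const _)).app <| (internal_const _).app <|
    ((internal_const _).app ((internal_const _).app hf)).app (internal_const _)

@[fun_prop]
theorem Internal.sub {σ : Ty} {f g : 𝔐.Carrier σ → 𝔐.Carrier .nat} (hf : Internal f)
    (hg : Internal g) : Internal fun x => f x - g x := by
  simp only [sub_def]
  exact (((internal_const _).app hg).app hf).app (internal_const _)

theorem add_zero' (a : 𝔐.Carrier .nat) : a + 0 = a := R_zero _ _

theorem add_succ (a b : 𝔐.Carrier .nat) : a + 𝔐.succ ⊙ b = 𝔐.succ ⊙ (a + b) := by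
  simp only [add_def, R_succ, S_app, K_app]

theorem mul_zero' (a : 𝔐.Carrier .nat) : a * 0 = 0 := R_zero _ _

theorem mul_succ (a b : 𝔐.Carrier .nat) : a * 𝔐.succ ⊙ b = a * b + a := by
  simp only [mul_def, add_def, R_succ, S_app, K_app]

theorem pred_zero : 𝔐.pred ⊙ 0 = 0 := by
  simp only [pred, S_app, K_app]
  exact R_zero _ _

theorem pred_succ (a : 𝔐.Carrier .nat) : 𝔐.pred ⊙ (𝔐.succ ⊙ a) = a := by
  simp only [pred, S_app, K_app, R_succ]

theorem sub_zero' (a : 𝔐.Carrier .nat) : a - 0 = a := R_zero _ _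

theorem sub_succ (a b : 𝔐.Carrier .nat) : a - 𝔐.succ ⊙ b = 𝔐.pred ⊙ (a - b) := by
  simp only [sub_def, R_succ, S_app, K_app]

theorem zero_add' (a : 𝔐.Carrier .nat) : 0 + a = a := by
  induction a using induction with
  | hP => exact qfDef_eq (by fun_prop) (by fun_prop)
  | h0 => exact add_zero' 0
  | hs a ih => rw [add_succ, ih]

theorem succ_add (a b : 𝔐.Carrier .nat) : 𝔐.succ ⊙ a + b = 𝔐.succ ⊙ (a + b) := by
  induction b using induction with
  | hP => exact qfDef_eq (by fun_prop) (by fun_prop)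
  | h0 => rw [zero_def, add_zero', add_zero']
  | hs b ih => rw [add_succ, ih, add_succ]

theorem add_comm' (a b : 𝔐.Carrier .nat) : a + b = b + a := by
  induction b using induction with
  | hP => exact qfDef_eq (by fun_prop) (by fun_prop)
  | h0 => rw [zero_def, add_zero', zero_add']
  | hs b ih => rw [add_succ, ih, succ_add]

theorem add_assoc' (a b c : 𝔐.Carrier .nat) : a + b + c = a + (b + c) := by
  induction c using induction with
  | hP => exact qfDef_eq (by fun_prop) (by fun_prop)
  | h0 => rw [zero_def, add_zero', add_zero']
  | hs c ih => rw [add_succ, ih, add_succ, add_succ]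

/-- Addition makes the numbers of a model a commutative monoid. -/
instance : AddCommMonoid (𝔐.Carrier .nat) where
  add_assoc := add_assoc'
  zero_add := zero_add'
  add_zero := add_zero'
  add_comm := add_comm'
  nsmul := nsmulRec

theorem succ_eq (a : 𝔐.Carrier .nat) : 𝔐.succ ⊙ a = a + 1 := by
  conv_lhs => rw [← add_zero' a, ← add_succ]
  rfl

theorem zero_mul' (a : 𝔐.Carrier .nat) : 0 * a = 0 := by
  induction a using induction with
  | hP => exact qfDef_eq (by fun_prop) (by fun_prop)
  | h0 => exact mul_zero' 0
  | hs a ih => rw [mul_succ, ih, add_zero]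

theorem add_one_mul' (a b : 𝔐.Carrier .nat) : (a + 1) * b = a * b + b := by
  induction b using induction with
  | hP => exact qfDef_eq (by fun_prop) (by fun_prop)
  | h0 => rw [zero_def, mul_zero', mul_zero', add_zero]
  | hs b ih => rw [mul_succ, ih, mul_succ, succ_eq]; abel

theorem mul_comm' (a b : 𝔐.Carrier .nat) : a * b = b * a := by
  induction b using induction with
  | hP => exact qfDef_eq (by fun_prop) (by fun_prop)
  | h0 => rw [zero_def, mul_zero', zero_mul']
  | hs b ih => rw [mul_succ, ih, succ_eq, add_one_mul']

theorem mul_add' (a b c : 𝔐.Carrier .nat) : a * (b + c) = a * b + a * c := by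
  induction c using induction with
  | hP => exact qfDef_eq (by fun_prop) (by fun_prop)
  | h0 => rw [zero_def, mul_zero', add_zero, add_zero]
  | hs c ih => rw [add_succ, mul_succ, ih, mul_succ, add_assoc]

theorem mul_assoc' (a b c : 𝔐.Carrier .nat) : a * b * c = a * (b * c) := by
  induction c using induction with
  | hP => exact qfDef_eq (by fun_prop) (by fun_prop)
  | h0 => rw [zero_def, mul_zero', mul_zero', mul_zero']
  | hs c ih => rw [mul_succ, ih, mul_succ, mul_add']

/-- The numbers of a model form a commutative semiring. -/
instance : CommSemiring (𝔐.Carrier .nat) where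
  left_distrib := mul_add'
  right_distrib a b c := by rw [mul_comm', mul_add', mul_comm' c, mul_comm' c]
  zero_mul := zero_mul'
  mul_zero := mul_zero'
  mul_assoc := mul_assoc'
  one_mul a := by
    have h := add_one_mul' 0 a
    rwa [zero_add, zero_mul', zero_add] at h
  mul_one a := by
    have h := mul_succ a 0
    rwa [succ_eq, zero_add, mul_zero', zero_add] at h
  mul_comm := mul_comm'

theorem add_one_ne_zero (a : 𝔐.Carrier .nat) : a + 1 ≠ 0 := by
  rw [← succ_eq]
  exact succ_ne_zero a

/-- The explicit predecessor in place of an existential quantifier keeps the induction predicate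
quantifier-free. -/
theorem eq_zero_or_eq_add_one (a : 𝔐.Carrier .nat) : a = 0 ∨ a = 𝔐.pred ⊙ a + 1 := by
  induction a using induction with
  | hP => exact (qfDef_eq (by fun_prop) (by fun_prop)).or (qfDef_eq (by fun_prop) (by fun_prop))
  | h0 => exact .inl rfl
  | hs a _ => exact .inr (by rw [pred_succ, succ_eq])

theorem exists_eq_add_one {a : 𝔐.Carrier .nat} (h : a ≠ 0) : ∃ b, a = b + 1 :=
  ⟨_, (eq_zero_or_eq_add_one a).resolve_left h⟩

theorem eq_zero_of_add_eq_zero {a b : 𝔐.Carrier .nat} (h : a + b = 0) : a = 0 ∧ b = 0 := by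
  have hb : b = 0 := by
    by_contra hb
    obtain ⟨c, rfl⟩ := exists_eq_add_one hb
    exact add_one_ne_zero (a + c) (by rw [← h, add_assoc])
  exact ⟨by rwa [hb, add_zero] at h, hb⟩

theorem add_one_sub_add_one (a b : 𝔐.Carrier .nat) : a + 1 - (b + 1) = a - b := by
  induction b using induction with
  | hP => exact qfDef_eq (by fun_prop) (by fun_prop)
  | h0 => rw [zero_def, ← succ_eq 0, sub_succ, sub_zero', sub_zero', ← succ_eq, pred_succ]
  | hs b ih => rw [← succ_eq (_ ⊙ b), sub_succ, succ_eq b, ih, ← succ_eq, sub_succ]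

theorem add_sub_cancel_left' (a b : 𝔐.Carrier .nat) : a + b - a = b := by
  induction a using induction with
  | hP => exact qfDef_eq (by fun_prop) (by fun_prop)
  | h0 => rw [zero_def, zero_add, sub_zero']
  | hs a ih => rw [succ_add, succ_eq, succ_eq, add_one_sub_add_one, ih]

theorem add_left_cancel' {a b c : 𝔐.Carrier .nat} (h : a + b = a + c) : b = c := by
  rw [← add_sub_cancel_left' a b, h, add_sub_cancel_left']

theorem sub_add_self (a b : 𝔐.Carrier .nat) : a - (a + b) = 0 := by
  induction a using induction with
  | hP => exact qfDef_eq (by fun_prop) (by fun_prop)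
  | h0 =>
    induction b using induction with
    | hP => exact qfDef_eq (by fun_prop) (by fun_prop)
    | h0 => rw [zero_def, add_zero, sub_zero']
    | hs b ih => rw [add_succ, sub_succ, ih, pred_zero]
  | hs a ih => rw [succ_add, succ_eq, succ_eq, add_one_sub_add_one, ih]

theorem eq_add_or_eq_add (a b : 𝔐.Carrier .nat) : (∃ c, a = b + c) ∨ ∃ c, b = a + c := by
  -- Truncated differences serve as explicit witnesses, since the existential statement is not
  -- available to induction.
  have h : a = b + (a - b) ∨ b = a + (b - a) := by
    induction a using induction with
    | hP => exact (qfDef_eq (by fun_prop) (by fun_prop)).or (qfDef_eq (by fun_prop) (by fun_prop))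
    | h0 => exact .inr (by rw [zero_def, zero_add, sub_zero'])
    | hs a ih =>
      rw [succ_eq]
      rcases ih with h | h
      · left
        rw [h, add_assoc, add_sub_cancel_left']
      · rcases eq_zero_or_eq_add_one (b - a) with h' | h'
        · left
          rw [h', add_zero] at h
          rw [h, add_sub_cancel_left']
        · right
          obtain ⟨c, hc⟩ : ∃ c, b = a + 1 + c :=
            ⟨𝔐.pred ⊙ (b - a), by rwa [h', add_comm _ 1, ← add_assoc] at h⟩
          rw [hc, add_sub_cancel_left']
  exact h.imp (fun h => ⟨_, h⟩) fun h => ⟨_, h⟩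

theorem sub_add_sub_eq_zero {a b : 𝔐.Carrier .nat} : a - b + (b - a) = 0 ↔ a = b := by
  constructor
  · intro h
    obtain ⟨h₁, h₂⟩ := eq_zero_of_add_eq_zero h
    rcases eq_add_or_eq_add a b with ⟨c, rfl⟩ | ⟨c, rfl⟩
    · rw [add_sub_cancel_left'] at h₁
      rw [h₁, add_zero]
    · rw [add_sub_cancel_left'] at h₂
      rw [h₂, add_zero]
  · rintro rfl
    have h := sub_add_self a 0
    rw [add_zero] at h
    rw [h, add_zero]

theorem one_sub_eq_zero {a : 𝔐.Carrier .nat} : 1 - a = 0 ↔ a ≠ 0 := by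
  constructor
  · rintro h rfl
    rw [sub_zero'] at h
    exact add_one_ne_zero 0 (by rwa [zero_add])
  · intro h
    obtain ⟨b, rfl⟩ := exists_eq_add_one h
    rw [add_comm, sub_add_self]

/-- The values of the pairing function at the diagonal determine the components. -/
theorem eq_of_pair_eq_pair {i j k : 𝔐.Carrier .nat}
    (h : (i + j) * (i + j) + i = (k + k) * (k + k) + k) : i = k ∧ j = k := by
  rcases eq_add_or_eq_add (i + j) (k + k) with ⟨c, hc⟩ | ⟨c, hc⟩
  · have hc0 : c = 0 := by
      by_contra hne
      obtain ⟨d, rfl⟩ := exists_eq_add_one hne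
      rw [hc] at h
      -- With `i + j = 2k + d + 1`, this number plus one is the excess of the left side of `h` over
      -- the right side: the gap between the squares outweighs the summand `k`.
      refine add_one_ne_zero (4 * k * d + 3 * k + d * d + 2 * d + i)
        (add_left_cancel' (a := (k + k) * (k + k) + k) ?_)
      rw [add_zero]
      exact .trans (by ring) h
    rw [hc0, add_zero] at hc
    rw [hc] at h
    have := add_left_cancel' h
    subst this
    exact ⟨rfl, add_left_cancel' hc⟩
  · have hc0 : c = 0 := by
      by_contra hne
      obtain ⟨d, rfl⟩ := exists_eq_add_one hne
      rw [hc] at h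
      refine add_one_ne_zero (i + 2 * j + 2 * (i + j) * d + d * d + 2 * d + k)
        (add_left_cancel' (a := (i + j) * (i + j) + i) ?_)
      rw [add_zero]
      exact .trans (by ring) h.symm
    rw [hc0, add_zero] at hc
    rw [hc] at h
    have := add_left_cancel' h
    subst this
    exact ⟨rfl, (add_left_cancel' hc).symm⟩

/-! ## The sentences in models -/

/-- `f(μ(f)) = 0` whenever `f` has a zero. -/
def IsMu (μ : 𝔐.Carrier .two) : Prop :=
  ∀ f : 𝔐.Carrier .one, (∃ n : 𝔐.Carrier .nat, f ⊙ n = 0) → f ⊙ (μ ⊙ f) = 0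

/-- `(i, j) ∈ X` for the pairing function `(i, j) = (i + j)² + i`. -/
def LeX (X : 𝔐.Carrier .one) (i j : 𝔐.Carrier .nat) : Prop :=
  X ⊙ ((i + j) * (i + j) + i) = 1

/-- `X` is a linear order. -/
structure IsLO (X : 𝔐.Carrier .one) : Prop where
  isSet : ∀ n : 𝔐.Carrier .nat, X ⊙ n = 0 ∨ X ⊙ n = 1
  field : ∀ i j, LeX X i j → LeX X i i ∧ LeX X j j
  trans : ∀ i j k, LeX X i j → LeX X j k → LeX X i k
  antisymm : ∀ i j, LeX X i j → LeX X j i → i = j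
  total : ∀ i j, LeX X i i → LeX X j j → LeX X i j ∨ LeX X j i

/-- Every sequence in `X` fails to be ascending and fails to be descending before `g`. -/
def NotAscNotDesc (X : 𝔐.Carrier .one) (g : 𝔐.Carrier .two) : Prop :=
  ∀ x : 𝔐.Carrier .one, (∀ n : 𝔐.Carrier .nat, LeX X (x ⊙ n) (x ⊙ n)) →
    ∃ n k : 𝔐.Carrier .nat, (n - g ⊙ x = 0 ∧ k - g ⊙ x = 0) ∧
      LeX X (x ⊙ n) (x ⊙ (𝔐.succ ⊙ n)) ∧ LeX X (x ⊙ (𝔐.succ ⊙ k)) (x ⊙ k)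

/-- `Φ(X, g)(1)` and `Φ(X, g)(2)` are bounds for `X`. -/
def IsBound (Φ : 𝔐.Carrier .bound) : Prop :=
  ∀ (X : 𝔐.Carrier .one) (g : 𝔐.Carrier .two), IsLO X → NotAscNotDesc X g →
    ∀ m, LeX X m m → LeX X (Φ ⊙ X ⊙ g ⊙ 1) m ∧ LeX X m (Φ ⊙ X ⊙ g ⊙ (1 + 1))

theorem sat_MUBody (v : 𝔐.Val) : Interp.Sat v MUBody ↔ IsMu (v .two 0) := by
  simp [MUBody, IsMu, Interp.eval]
  rfl

theorem eval_two (v : 𝔐.Val) : Interp.eval v Tm.two = 1 + 1 := succ_eq 1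

theorem sat_leX (v : 𝔐.Val) (X : Tm .one) (i j : Tm .nat) :
    Interp.Sat v (.leX X i j) ↔
      LeX (Interp.eval v X) (Interp.eval v i) (Interp.eval v j) := .rfl

theorem sat_LO (v : 𝔐.Val) (X : Tm .one) :
    Interp.Sat v (.LO X) ↔ IsLO (Interp.eval v X) := by
  simp only [Form.LO, Interp.sat_and, Form.isSet, Interp.sat_all, Interp.sat_or, Interp.sat_eq,
    Interp.eval, Interp.eval_lift, eval_one, Interp.sat_imp, sat_leX, Form.inField]
  simp only [Interp.Val.cons_zero, Interp.Val.cons_succ]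
  constructor
  · rintro ⟨h, h'⟩
    exact ⟨h, fun i j => (h' i j i).1, fun i j k hij hjk => (h' i j k).2.1 ⟨hij, hjk⟩,
      fun i j hij hji => (h' i j i).2.2.1 ⟨hij, hji⟩,
      fun i j hi hj => (h' i j i).2.2.2 ⟨hi, hj⟩⟩
  · exact fun h => ⟨h.isSet, fun i j k => ⟨h.field i j, fun hh => h.trans i j k hh.1 hh.2,
      fun hh => h.antisymm i j hh.1 hh.2, fun hh => h.total i j hh.1 hh.2⟩⟩

theorem sat_UADS2Body (v : 𝔐.Val) : Interp.Sat v UADS2Body ↔ IsBound (v .bound 0) := by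
  simp only [UADS2Body, IsBound, Interp.sat_all, Interp.sat_imp, sat_LO, Interp.eval,
    Interp.eval_lift, Form.isSeq, Form.inField, sat_leX, Form.notAscNotDesc, Interp.sat_ex,
    Interp.sat_and, Form.le, Interp.sat_eq, eval_sub, eval_one, eval_two,
    NotAscNotDesc]
  simp
  rfl

end Model
/-! ## The closed terms -/

namespace Tm

/-- Case distinction: `a` if `c = 0`, and `b` otherwise. -/
def cond (c a b : Tm .nat) : Tm .nat :=
  .R ⬝ c ⬝ a ⬝ (.K (.nat ⇾ .nat) .nat ⬝ (.K .nat .nat ⬝ b))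

/-- The step `λ r i. (r if f(r) = 0, and i + 1 otherwise)` of bounded search for a zero of `f`,
in the variable `f` (variable `0` of type `1`). -/
def searchStep : Tm (.nat ⇾ .nat ⇾ .nat) :=
  lam .nat (lam .nat (cond (.var .one 0 ⬝ .var .nat 1) (.var .nat 1) (.succ ⬝ .var .nat 0)))

/-- The first zero of `f` below `n` if there is one, and `n` otherwise. -/
def search (n : Tm .nat) : Tm .nat := .R ⬝ n ⬝ .zero ⬝ searchStep

/-- The linear order whose field consists of the first zero of `f`, if there is one. -/
def firstZeroOrder : Tm .one :=
  let p : Tm .nat := .var .nat 0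
  let w := search p
  lam .nat (cond (add (add (sub p (pair w w)) (sub (pair w w) p)) (.var .one 0 ⬝ w)) one .zero)

/-- The term `λ Φ f. Φ(X, 0)(1)`, where `X` is the order given by the first zero of `f`. -/
def muOfBound : Tm (.bound ⇾ .two) :=
  lam .bound (lam .one
    (.var .bound 0 ⬝ firstZeroOrder ⬝ (.K .nat .one ⬝ .zero) ⬝ one))

/-- `λ m y. c` where `c = 0` if and only if `y` is strictly below `m` in `X`. -/
def strictlyBelow : Tm (.nat ⇾ .nat ⇾ .nat) :=
  let m : Tm .nat := .var .nat 1
  let y : Tm .nat := .var .nat 0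
  lam .nat (lam .nat (add (sub one (.var .one 0 ⬝ pair y m)) (.var .one 0 ⬝ pair m y)))

/-- `λ m y. c` where `c = 0` if and only if `y` is strictly above `m` in `X`. -/
def strictlyAbove : Tm (.nat ⇾ .nat ⇾ .nat) :=
  let m : Tm .nat := .var .nat 1
  let y : Tm .nat := .var .nat 0
  lam .nat (lam .nat (add (sub one (.var .one 0 ⬝ pair m y)) (.var .one 0 ⬝ pair y m)))

/-- The term `λ m. e` where `e = 0` if and only if `m` is in the field of `X` and `c(m, y) ≠ 0` for
`y = μ(c(m))`, in the variables `X`, `μ` and `c`. -/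
def extremumTest : Tm .one :=
  let m : Tm .nat := .var .nat 0
  let c : Tm (.nat ⇾ .nat ⇾ .nat) := .var (.nat ⇾ .nat ⇾ .nat) 0
  lam .nat
    (add (sub one (.var .one 0 ⬝ pair m m)) (sub one (c ⬝ m ⬝ (.var .two 1 ⬝ (c ⬝ m)))))

/-- The term `λ c. μ(λ m. e)` for the test `λ m. e` of `extremumTest`. -/
def extremum : Tm ((.nat ⇾ .nat ⇾ .nat) ⇾ .nat) :=
  lam (.nat ⇾ .nat ⇾ .nat) (.var .two 1 ⬝ extremumTest)

/-- The term that maps `μ`, `X` and `g` to the function that is the least element of `X` at `1`,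
and the greatest one at `2`. -/
def boundOfMu : Tm (.two ⇾ .bound) :=
  lam .two (lam .one (lam .two (lam .nat
    (cond (pred ⬝ .var .nat 0) (extremum ⬝ strictlyBelow) (extremum ⬝ strictlyAbove)))))

section VarsBelow

variable {k : Ty → ℕ}

theorem VarsBelow.add {a b : Tm .nat} (ha : a.VarsBelow k) (hb : b.VarsBelow k) :
    (add a b).VarsBelow k := by
  simp [Tm.add, step, VarsBelow, ha, hb]

theorem VarsBelow.mul {a b : Tm .nat} (ha : a.VarsBelow k) (hb : b.VarsBelow k) :
    (mul a b).VarsBelow k := by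
  simp [Tm.mul, step, addRight, VarsBelow, ha, hb]

theorem varsBelow_pred : pred.VarsBelow k := by
  simp [pred, idN, VarsBelow]

theorem VarsBelow.sub {a b : Tm .nat} (ha : a.VarsBelow k) (hb : b.VarsBelow k) :
    (sub a b).VarsBelow k := by
  simp [Tm.sub, step, VarsBelow, ha, hb, varsBelow_pred]

theorem VarsBelow.pair {a b : Tm .nat} (ha : a.VarsBelow k) (hb : b.VarsBelow k) :
    (pair a b).VarsBelow k := ((ha.add hb).mul (ha.add hb)).add ha

theorem varsBelow_one : one.VarsBelow k := ⟨trivial, trivial⟩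

theorem VarsBelow.cond {c a b : Tm .nat} (hc : c.VarsBelow k) (ha : a.VarsBelow k)
    (hb : b.VarsBelow k) : (cond c a b).VarsBelow k := by
  simp [Tm.cond, VarsBelow, hc, ha, hb]

theorem varsBelow_searchStep (h : 0 < k .one) : searchStep.VarsBelow k :=
  .lam (.lam (.cond (by simp [VarsBelow, h]) (by simp [VarsBelow]) (by simp [VarsBelow])))

theorem varsBelow_firstZeroOrder (h : 0 < k .one) : firstZeroOrder.VarsBelow k := by
  refine .lam ?_
  generalize hk : (fun ρ => if ρ = Ty.nat then k ρ + 1 else k ρ) = k'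
  have hn : (Tm.var .nat 0).VarsBelow k' := by simp [VarsBelow, ← hk]
  have ho : 0 < k' .one := by simp [← hk, h]
  have hw : (search (.var .nat 0)).VarsBelow k' :=
    ⟨⟨⟨trivial, hn⟩, trivial⟩, varsBelow_searchStep ho⟩
  exact .cond (((hn.sub (hw.pair hw)).add ((hw.pair hw).sub hn)).add ⟨ho, hw⟩) varsBelow_one trivial

theorem closed_muOfBound : muOfBound.Closed :=
  VarsBelow.closed <| .lam <| .lam ⟨⟨⟨by simp [VarsBelow], varsBelow_firstZeroOrder (by simp)⟩,
    ⟨trivial, trivial⟩⟩, varsBelow_one⟩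

theorem varsBelow_strictlyBelow (h : 0 < k .one) : strictlyBelow.VarsBelow k := by
  refine .lam (.lam (.add (.sub varsBelow_one ⟨?_, .pair ?_ ?_⟩) ⟨?_, .pair ?_ ?_⟩)) <;>
    simp [VarsBelow, h]

theorem varsBelow_strictlyAbove (h : 0 < k .one) : strictlyAbove.VarsBelow k := by
  refine .lam (.lam (.add (.sub varsBelow_one ⟨?_, .pair ?_ ?_⟩) ⟨?_, .pair ?_ ?_⟩)) <;>
    simp [VarsBelow, h]

theorem varsBelow_extremum (h₁ : 0 < k .one) (h₂ : 1 < k .two) : extremum.VarsBelow k := by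
  refine .lam ⟨by simp [VarsBelow, h₂], .lam (.add (.sub varsBelow_one ⟨?_, .pair ?_ ?_⟩)
    (.sub varsBelow_one ?_))⟩ <;>
    simp [VarsBelow, h₁, h₂]

theorem closed_boundOfMu : boundOfMu.Closed :=
  VarsBelow.closed <| .lam <| .lam <| .lam <| .lam <| .cond ⟨varsBelow_pred, by simp [VarsBelow]⟩
    ⟨varsBelow_extremum (by simp) (by simp), varsBelow_strictlyBelow (by simp)⟩
    ⟨varsBelow_extremum (by simp) (by simp), varsBelow_strictlyAbove (by simp)⟩

end VarsBelow

end Tm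

/-! ### Values of the closed terms in models -/

namespace Model

variable {𝔐 : Model}

@[simp] theorem eval_app (v : 𝔐.Val) {σ τ : Ty} (f : Tm (σ ⇾ τ)) (a : Tm σ) :
    Interp.eval v (f ⬝ a) = Interp.eval v f ⊙ Interp.eval v a := rfl

@[simp] theorem eval_var (v : 𝔐.Val) (σ : Ty) (n : ℕ) : Interp.eval v (.var σ n) = v σ n := rfl

@[simp] theorem eval_succ (v : 𝔐.Val) : Interp.eval v .succ = 𝔐.succ := rfl

@[simp] theorem eval_pair (v : 𝔐.Val) (i j : Tm .nat) :
    Interp.eval v (Tm.pair i j) = (Interp.eval v i + Interp.eval v j) *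
      (Interp.eval v i + Interp.eval v j) + Interp.eval v i := rfl

open Classical in
@[simp] theorem eval_cond (v : 𝔐.Val) (c a b : Tm .nat) : Interp.eval v (Tm.cond c a b) =
    if Interp.eval v c = 0 then Interp.eval v a else Interp.eval v b := by
  change 𝔐.R ⊙ _ ⊙ _ ⊙ (𝔐.K _ _ ⊙ (𝔐.K _ _ ⊙ _)) = _
  split_ifs with h
  · rw [h]
    exact R_zero _ _
  · obtain ⟨d, hd⟩ := exists_eq_add_one h
    rw [hd, ← succ_eq, R_succ, K_app, K_app]

/-! ## From bounds of linear orders to zeros of functions -/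

section Search

variable {f : 𝔐.Carrier .one} {s : 𝔐.Carrier (.nat ⇾ .nat ⇾ .nat)}

open Classical in
/-- The function `s` is the step of bounded search for a zero of `f`. -/
def IsSearchStep (f : 𝔐.Carrier .one) (s : 𝔐.Carrier (.nat ⇾ .nat ⇾ .nat)) : Prop :=
  ∀ r i : 𝔐.Carrier .nat, s ⊙ r ⊙ i = if f ⊙ r = 0 then r else i + 1

theorem IsSearchStep.search_succ_of_zero (hs : IsSearchStep f s) {n : 𝔐.Carrier .nat}
    (h : f ⊙ (𝔐.R ⊙ n ⊙ 0 ⊙ s) = 0) :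
    𝔐.R ⊙ (𝔐.succ ⊙ n) ⊙ 0 ⊙ s = 𝔐.R ⊙ n ⊙ 0 ⊙ s := by
  rw [R_succ, hs, if_pos h]

theorem IsSearchStep.search_add (hs : IsSearchStep f s) {n : 𝔐.Carrier .nat}
    (h : f ⊙ (𝔐.R ⊙ n ⊙ 0 ⊙ s) = 0) (k : 𝔐.Carrier .nat) :
    𝔐.R ⊙ (n + k) ⊙ 0 ⊙ s = 𝔐.R ⊙ n ⊙ 0 ⊙ s := by
  induction k using induction with
  | hP => exact qfDef_eq (by fun_prop) (by fun_prop)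
  | h0 => rw [zero_def, add_zero]
  | hs k ih => rw [add_succ, hs.search_succ_of_zero (by rwa [ih]), ih]

theorem IsSearchStep.search_eq_of_zero (hs : IsSearchStep f s) {m n : 𝔐.Carrier .nat}
    (hm : f ⊙ (𝔐.R ⊙ m ⊙ 0 ⊙ s) = 0) (hn : f ⊙ (𝔐.R ⊙ n ⊙ 0 ⊙ s) = 0) :
    𝔐.R ⊙ m ⊙ 0 ⊙ s = 𝔐.R ⊙ n ⊙ 0 ⊙ s := by
  rcases eq_add_or_eq_add m n with ⟨k, rfl⟩ | ⟨k, rfl⟩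
  · exact hs.search_add hn k
  · exact (hs.search_add hm k).symm

/-- The invariant of the search: the step returns the next stage `i + 1` until a zero is met, and
from then on the value is frozen. -/
theorem IsSearchStep.zero_or_eq (hs : IsSearchStep f s) (n : 𝔐.Carrier .nat) :
    f ⊙ (𝔐.R ⊙ n ⊙ 0 ⊙ s) = 0 ∨ 𝔐.R ⊙ n ⊙ 0 ⊙ s = n := by
  induction n using induction with
  | hP => exact (qfDef_eq (by fun_prop) (by fun_prop)).or (qfDef_eq (by fun_prop) (by fun_prop))
  | h0 => exact .inr (R_zero _ _)
  | hs n _ =>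
    by_cases h : f ⊙ (𝔐.R ⊙ n ⊙ 0 ⊙ s) = 0
    · exact .inl (by rwa [hs.search_succ_of_zero h])
    · exact .inr (by rw [R_succ, hs, if_neg h, succ_eq])

/-- If `f` has a zero, then bounded search for it becomes constant at a zero. -/
theorem IsSearchStep.exists_first (hs : IsSearchStep f s) {n : 𝔐.Carrier .nat} (hn : f ⊙ n = 0) :
    ∃ i, f ⊙ i = 0 ∧ ∀ k, 𝔐.R ⊙ (i + k) ⊙ 0 ⊙ s = i := by
  have h : f ⊙ (𝔐.R ⊙ n ⊙ 0 ⊙ s) = 0 := by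
    rcases hs.zero_or_eq n with h | h
    · exact h
    · rwa [h]
  refine ⟨_, h, fun k => ?_⟩
  -- The zero found is also returned when it is itself taken as the search bound; hence it is
  -- returned for all larger bounds.
  have h' : 𝔐.R ⊙ (𝔐.R ⊙ n ⊙ 0 ⊙ s) ⊙ 0 ⊙ s = 𝔐.R ⊙ n ⊙ 0 ⊙ s := by
    rcases hs.zero_or_eq (𝔐.R ⊙ n ⊙ 0 ⊙ s) with h' | h'
    · exact hs.search_eq_of_zero h' h
    · exact h'
  rw [hs.search_add (by rwa [h']), h']

theorem isSearchStep_eval (v : 𝔐.Val) :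
    IsSearchStep (v .one 0) (Interp.eval v Tm.searchStep) := by
  intro r i
  have h : Interp.eval ((v.cons r).cons i) (.var .one 0 ⬝ .var .nat 1) = v .one 0 ⊙ r := by simp
  rw [Tm.searchStep, eval_lam, eval_lam, eval_cond, h]
  simp [succ_eq]

end Search

open Classical in
theorem eval_firstZeroOrder_app (v : 𝔐.Val) (p : 𝔐.Carrier .nat) :
    Interp.eval v Tm.firstZeroOrder ⊙ p =
      let w := 𝔐.R ⊙ p ⊙ 0 ⊙ Interp.eval v Tm.searchStep
      if p = (w + w) * (w + w) + w ∧ v .one 0 ⊙ w = 0 then 1 else 0 := by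
  -- The search step depends on `f` alone, so the new number variable `p` does not affect it.
  have hs : Interp.eval (v.cons p) Tm.searchStep = Interp.eval v Tm.searchStep :=
    𝔐.app_ext _ _ fun r => 𝔐.app_ext _ _ fun i => by
      rw [isSearchStep_eval, isSearchStep_eval]
      simp
  have hw : Interp.eval (v.cons p) (Tm.search (.var .nat 0)) =
      𝔐.R ⊙ p ⊙ 0 ⊙ Interp.eval v Tm.searchStep := by
    rw [← hs]
    simp [Tm.search]
    rfl
  simp only [Tm.firstZeroOrder, eval_lam, eval_cond, eval_add, eval_sub, eval_pair, eval_app, hw,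
    eval_var, Interp.Val.cons_zero, eval_one, eval_zero]
  congr 1
  refine propext ⟨fun h => ?_, fun ⟨h₁, h₂⟩ => ?_⟩
  · obtain ⟨h₁, h₂⟩ := eq_zero_of_add_eq_zero h
    exact ⟨sub_add_sub_eq_zero.1 h₁, by simpa using h₂⟩
  · rw [sub_add_sub_eq_zero.2 h₁, zero_add]
    simpa using h₂

theorem leX_firstZeroOrder (v : 𝔐.Val) {i j : 𝔐.Carrier .nat} :
    LeX (Interp.eval v Tm.firstZeroOrder) i j ↔ i = j ∧ v .one 0 ⊙ i = 0 ∧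
      𝔐.R ⊙ ((i + i) * (i + i) + i) ⊙ 0 ⊙ Interp.eval v Tm.searchStep = i := by
  rw [LeX, eval_firstZeroOrder_app]
  have h10 : (0 : 𝔐.Carrier .nat) ≠ 1 := by
    rw [← zero_add 1]
    exact (add_one_ne_zero 0).symm
  dsimp only
  constructor
  · intro h
    split_ifs at h with hp
    · obtain ⟨h₁, h₂⟩ := hp
      obtain ⟨hi, hj⟩ := eq_of_pair_eq_pair h₁
      have hij : i = j := hi.trans hj.symm
      subst hij
      exact ⟨rfl, by rwa [← hi] at h₂, hi.symm⟩
    · exact (h10 h).elim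
  · rintro ⟨rfl, h₁, h₂⟩
    rw [h₂, if_pos ⟨rfl, h₁⟩]

/-- Elements of the field are zeros returned by bounded searches, and any two successful searches
return the same zero. -/
theorem eq_of_leX_firstZeroOrder (v : 𝔐.Val) {i j : 𝔐.Carrier .nat}
    (hi : LeX (Interp.eval v Tm.firstZeroOrder) i i)
    (hj : LeX (Interp.eval v Tm.firstZeroOrder) j j) : i = j := by
  obtain ⟨-, hi, hi'⟩ := (leX_firstZeroOrder v).1 hi
  obtain ⟨-, hj, hj'⟩ := (leX_firstZeroOrder v).1 hj
  rw [← hi', ← hj']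
  exact (isSearchStep_eval v).search_eq_of_zero (by rwa [hi']) (by rwa [hj'])

theorem isLO_firstZeroOrder (v : 𝔐.Val) : IsLO (Interp.eval v Tm.firstZeroOrder) where
  isSet n := by
    rw [eval_firstZeroOrder_app]
    dsimp only
    split_ifs
    · exact .inr rfl
    · exact .inl rfl
  field i j h := by
    obtain rfl := ((leX_firstZeroOrder v).1 h).1
    exact ⟨h, h⟩
  trans i j k hij hjk := by
    obtain rfl := ((leX_firstZeroOrder v).1 hij).1
    exact hjk
  antisymm i j h _ := ((leX_firstZeroOrder v).1 h).1
  total i j hi hj := by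
    obtain rfl := eq_of_leX_firstZeroOrder v hi hj
    exact .inl hi

theorem isMu_muOfBound (v : 𝔐.Val) {Φ : 𝔐.Carrier .bound} (hΦ : IsBound Φ) :
    IsMu (Interp.eval v Tm.muOfBound ⊙ Φ) := by
  rintro f ⟨n, hn⟩
  let u := (v.cons Φ).cons f
  have hf : u .one 0 = f := by simp [u]
  let g : 𝔐.Carrier .two := 𝔐.K .nat .one ⊙ 0
  have hval : Interp.eval v Tm.muOfBound ⊙ Φ ⊙ f =
      Φ ⊙ Interp.eval u Tm.firstZeroOrder ⊙ g ⊙ 1 := by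
    rw [Tm.muOfBound, eval_lam, eval_lam]
    simp [u]
    rfl
  obtain ⟨i, hi, hi'⟩ := (isSearchStep_eval u).exists_first (n := n) (by rwa [hf])
  -- The code `(i, i) = (i + i)² + i` is at least `i`, so a search bounded by the code itself
  -- reaches `i`.
  have hfield : LeX (Interp.eval u Tm.firstZeroOrder) i i :=
    (leX_firstZeroOrder u).2 ⟨rfl, hi, by rw [add_comm _ i, hi']⟩
  have hseq : NotAscNotDesc (Interp.eval u Tm.firstZeroOrder) g := by
    intro x hx
    -- Sequences in an order with at most one element are constant, so `n = k = 0` is a witness.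
    have h0 : (0 : 𝔐.Carrier .nat) - g ⊙ x = 0 := by rw [K_app, sub_zero']
    have h1 := eq_of_leX_firstZeroOrder u (hx 0) (hx (𝔐.succ ⊙ 0))
    refine ⟨0, 0, ⟨h0, h0⟩, ?_⟩
    rw [← h1]
    exact ⟨hx 0, hx 0⟩
  have h := (hΦ _ g (isLO_firstZeroOrder u) hseq i hfield).1
  rw [← hval] at h
  rw [((leX_firstZeroOrder u).1 h).1, ← hf]
  exact hi

/-! ## From zeros of functions to bounds of linear orders -/

/-- Let `c(m, y) = 0` imply that `y` is in the field of `X`. If there is no sequence `x` in `X` with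
`c(x_n, x_{n+1}) = 0` for all `n`, then `μ` finds an element `m` of `X` with `c(m, y) ≠ 0` for
all `y`. -/
theorem eval_extremum_spec (v : 𝔐.Val) {X : 𝔐.Carrier .one} (hX : v .one 0 = X)
    (hμ : IsMu (v .two 1)) {c : 𝔐.Carrier (.nat ⇾ .nat ⇾ .nat)}
    (hset : ∀ n : 𝔐.Carrier .nat, X ⊙ n = 0 ∨ X ⊙ n = 1)
    (hc : ∀ m y : 𝔐.Carrier .nat, c ⊙ m ⊙ y = 0 → LeX X y y)
    (hseq : ∀ x : 𝔐.Carrier .one, (∀ n : 𝔐.Carrier .nat, LeX X (x ⊙ n) (x ⊙ n)) →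
      ¬ ∀ n : 𝔐.Carrier .nat, c ⊙ (x ⊙ n) ⊙ (x ⊙ (𝔐.succ ⊙ n)) = 0)
    {m₀ : 𝔐.Carrier .nat} (hm₀ : LeX X m₀ m₀) :
    LeX X (Interp.eval v Tm.extremum ⊙ c) (Interp.eval v Tm.extremum ⊙ c) ∧
      ∀ y, c ⊙ (Interp.eval v Tm.extremum ⊙ c) ⊙ y ≠ 0 := by
  obtain ⟨μ, hμv⟩ : ∃ μ, v .two 1 = μ := ⟨_, rfl⟩
  rw [hμv] at hμ
  obtain ⟨e, he, hval⟩ : ∃ e : 𝔐.Carrier .one, (∀ m : 𝔐.Carrier .nat, e ⊙ m = 0 ↔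
      LeX X m m ∧ c ⊙ m ⊙ (μ ⊙ (c ⊙ m)) ≠ 0) ∧ Interp.eval v Tm.extremum ⊙ c = μ ⊙ e := by
    refine ⟨Interp.eval (v.cons c) Tm.extremumTest, fun m => ?_, ?_⟩
    · have hone : X ⊙ ((m + m) * (m + m) + m) ≠ 0 ↔ LeX X m m := by
        refine ⟨(hset _).resolve_left, fun h h' => add_one_ne_zero (0 : 𝔐.Carrier .nat) ?_⟩
        rw [zero_add, ← h', h]
      have he : Interp.eval (v.cons c) Tm.extremumTest ⊙ m =
          1 - X ⊙ ((m + m) * (m + m) + m) + (1 - c ⊙ m ⊙ (μ ⊙ (c ⊙ m))) := by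
        rw [Tm.extremumTest, eval_lam, ← hμv, ← hX]
        simp
      rw [he, ← hone, ← one_sub_eq_zero, ← one_sub_eq_zero]
      exact ⟨eq_zero_of_add_eq_zero, fun h => by rw [h.1, h.2, add_zero]⟩
    · rw [Tm.extremum, eval_lam, eval_app, eval_var, Interp.Val.cons_of_ne (by simp), hμv]
  rw [hval]
  by_cases hex : ∃ m : 𝔐.Carrier .nat, e ⊙ m = 0
  · obtain ⟨h₁, h₂⟩ := (he _).1 (hμ e hex)
    exact ⟨h₁, fun y hy => h₂ (hμ _ ⟨y, hy⟩)⟩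
  -- Otherwise `μ(c(m))` is a successor of every `m` in the field. Iterating from `m₀` by the
  -- recursor gives a forbidden sequence, which counts only because it is an element of the model.
  · exfalso
    have hstep : ∀ m, LeX X m m → c ⊙ m ⊙ (μ ⊙ (c ⊙ m)) = 0 := fun m hm => by
      by_contra h
      exact hex ⟨m, (he m).2 ⟨hm, h⟩⟩
    obtain ⟨d, hd⟩ : Internal fun m => μ ⊙ (c ⊙ m) := by fun_prop
    obtain ⟨s, hs⟩ : Internal fun r => 𝔐.K .nat .nat ⊙ (d ⊙ r) := by fun_prop
    obtain ⟨x, hx⟩ : Internal fun n => 𝔐.R ⊙ n ⊙ m₀ ⊙ s := by fun_prop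
    beta_reduce at hd hs hx
    have hsucc : ∀ n : 𝔐.Carrier .nat, x ⊙ (𝔐.succ ⊙ n) = μ ⊙ (c ⊙ (x ⊙ n)) := fun n => by
      rw [hx, R_succ, hs, K_app, hd, hx]
    have hfield : ∀ n : 𝔐.Carrier .nat, LeX X (x ⊙ n) (x ⊙ n) := fun n => by
      induction n using induction with
      | hP =>
        unfold LeX
        exact qfDef_eq (by fun_prop) (by fun_prop)
      | h0 => rwa [hx, R_zero]
      | hs n ih =>
        rw [hsucc]
        exact hc _ _ (hstep _ ih)
    refine hseq x hfield fun n => ?_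
    rw [hsucc]
    exact hstep _ (hfield n)

/-- Characteristic functions take only the values `0` and `1`, so `1 - X(p)` expresses membership,
`X(q)` expresses non-membership, and a sum vanishes exactly when both summands do. -/
theorem IsLO.sub_add_eq_zero {X : 𝔐.Carrier .one} (hX : IsLO X) (i j : 𝔐.Carrier .nat) :
    1 - X ⊙ ((i + j) * (i + j) + i) + X ⊙ ((j + i) * (j + i) + j) = 0 ↔
      LeX X i j ∧ ¬ LeX X j i := by
  have h10 : (1 : 𝔐.Carrier .nat) ≠ 0 := by
    rw [← zero_add 1]
    exact add_one_ne_zero 0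
  have hne (n : 𝔐.Carrier .nat) : X ⊙ n ≠ 0 ↔ X ⊙ n = 1 :=
    ⟨(hX.isSet n).resolve_left, fun h => by rwa [h]⟩
  have heq (n : 𝔐.Carrier .nat) : X ⊙ n = 0 ↔ ¬ X ⊙ n = 1 := by rw [← hne, not_not]
  unfold LeX
  rw [← hne (_ + i), ← one_sub_eq_zero, ← heq]
  exact ⟨eq_zero_of_add_eq_zero, fun h => by rw [h.1, h.2, add_zero]⟩

theorem eval_below (v : 𝔐.Val) {X : 𝔐.Carrier .one} (hX : v .one 0 = X) (hLO : IsLO X)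
    (m y : 𝔐.Carrier .nat) :
    Interp.eval v Tm.strictlyBelow ⊙ m ⊙ y = 0 ↔ LeX X y m ∧ ¬ LeX X m y := by
  rw [← hLO.sub_add_eq_zero, Tm.strictlyBelow, eval_lam, eval_lam]
  simp [hX]

theorem eval_above (v : 𝔐.Val) {X : 𝔐.Carrier .one} (hX : v .one 0 = X) (hLO : IsLO X)
    (m y : 𝔐.Carrier .nat) :
    Interp.eval v Tm.strictlyAbove ⊙ m ⊙ y = 0 ↔ LeX X m y ∧ ¬ LeX X y m := by
  rw [← hLO.sub_add_eq_zero, Tm.strictlyAbove, eval_lam, eval_lam]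
  simp [hX]

theorem isBound_boundOfMu (v : 𝔐.Val) {μ : 𝔐.Carrier .two} (hμ : IsMu μ) :
    IsBound (Interp.eval v Tm.boundOfMu ⊙ μ) := by
  intro X g hX hg m hm
  let u (n : 𝔐.Carrier .nat) := (((v.cons μ).cons X).cons g).cons n
  have huX (n) : u n .one 0 = X := by simp [u]
  -- The index is `1` because `g`, also of type `2`, is bound inside `μ`.
  have huμ (n) : u n .two 1 = μ := by simp [u]
  have hval (n : 𝔐.Carrier .nat) : Interp.eval v Tm.boundOfMu ⊙ μ ⊙ X ⊙ g ⊙ n =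
      Interp.eval (u n) (.cond (Tm.pred ⬝ .var .nat 0) (Tm.extremum ⬝ Tm.strictlyBelow)
        (Tm.extremum ⬝ Tm.strictlyAbove)) := by
    rw [Tm.boundOfMu, eval_lam, eval_lam, eval_lam, eval_lam]
  have hp1 : 𝔐.pred ⊙ 1 = 0 := by
    rw [← zero_add 1, ← succ_eq, pred_succ]
  -- The predecessor separates the arguments `1` and `2`, which select the least and the greatest
  -- element.
  have hp2 : 𝔐.pred ⊙ (1 + 1) ≠ 0 := by
    rw [← succ_eq, pred_succ, ← zero_add 1]
    exact add_one_ne_zero 0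
  constructor
  · have h := eval_extremum_spec (u 1) (huX 1) (by rwa [huμ]) hX.isSet
      (c := Interp.eval (u 1) Tm.strictlyBelow)
      (fun m y h => (hX.field _ _ ((eval_below _ (huX 1) hX m y).1 h).1).1)
      -- A strictly descending sequence has no step with `x_n ≤_X x_{n+1}`, which `hg` provides.
      (fun x hx hall => by
        obtain ⟨n, -, -, h, -⟩ := hg x hx
        exact ((eval_below _ (huX 1) hX _ _).1 (hall n)).2 h) hm
    rw [hval, eval_cond]
    have : Interp.eval (u 1) (Tm.pred ⬝ .var .nat 0) = 0 := by simpa [u] using hp1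
    rw [if_pos this, eval_app]
    rcases hX.total _ _ h.1 hm with h' | h'
    · exact h'
    · by_contra h''
      exact h.2 m ((eval_below _ (huX 1) hX _ _).2 ⟨h', h''⟩)
  · have h := eval_extremum_spec (u (1 + 1)) (huX _) (by rwa [huμ]) hX.isSet
      (c := Interp.eval (u (1 + 1)) Tm.strictlyAbove)
      (fun m y h => (hX.field _ _ ((eval_above _ (huX _) hX m y).1 h).1).2)
      (fun x hx hall => by
        obtain ⟨-, k, -, -, h⟩ := hg x hx
        exact ((eval_above _ (huX _) hX _ _).1 (hall k)).2 h) hm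
    rw [hval, eval_cond]
    have : Interp.eval (u (1 + 1)) (Tm.pred ⬝ .var .nat 0) ≠ 0 := by simpa [u] using hp2
    rw [if_neg this, eval_app]
    rcases hX.total _ _ hm h.1 with h' | h'
    · exact h'
    · by_contra h''
      exact h.2 m ((eval_above _ (huX _) hX _ _).2 ⟨h', h''⟩)

/-! ### From truth in models to explicit provability -/

theorem sat_subst_cons_app (v : 𝔐.Val) {σ τ : Ty} (t : Tm (σ ⇾ τ)) (x : 𝔐.Carrier σ) (A : Form) :
    Interp.Sat (v.cons x) (A.subst (Sub.cons (t ⬝ .var σ 0) (Sub.shift σ))) ↔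
      Interp.Sat (v.cons (Interp.eval (v.cons x) t ⊙ x)) A := by
  rw [Interp.sat_subst, Interp.eval_cons, Interp.eval_shift]
  simp

end Model

/-- An implication is explicit if a closed term witnesses it in all models. -/
theorem explicitImp_of_model {σ τ : Ty} {A B : Form} {t : Tm (σ ⇾ τ)} (ht : t.Closed)
    (h : ∀ (𝔐 : Model) (v : 𝔐.Val) (x : 𝔐.Carrier σ), Interp.Sat (v.cons x) A →
      Interp.Sat (v.cons (Interp.eval (v.cons x) t ⊙ x)) B) :
    ExplicitImp RCA0ω σ τ A B := by
  refine ⟨proves_of_sat fun 𝔐 v => ?_, t, ht, proves_of_sat fun 𝔐 v x hx => ?_⟩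
  · rw [Interp.sat_imp, Interp.sat_ex, Interp.sat_ex]
    exact fun ⟨x, hx⟩ => ⟨_, h 𝔐 v x hx⟩
  · exact (Model.sat_subst_cons_app v t x B).2 (h 𝔐 v x hx)

theorem explicitImp_mu_of_bound : ExplicitImp RCA0ω .bound .two UADS2Body MUBody := by
  refine explicitImp_of_model Tm.closed_muOfBound fun 𝔐 v Φ hΦ => ?_
  rw [Model.sat_UADS2Body, Interp.Val.cons_zero] at hΦ
  rw [Model.sat_MUBody, Interp.Val.cons_zero]
  exact Model.isMu_muOfBound _ hΦ

theorem explicitImp_bound_of_mu : ExplicitImp RCA0ω .two .bound MUBody UADS2Body := by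
  refine explicitImp_of_model Tm.closed_boundOfMu fun 𝔐 v μ hμ => ?_
  rw [Model.sat_MUBody, Interp.Val.cons_zero] at hμ
  rw [Model.sat_UADS2Body, Interp.Val.cons_zero]
  exact Model.isBound_boundOfMu _ hμ

theorem Deriv.iffI {T : Set Form} {Γ : List Form} {A B : Form}
    (h₁ : Deriv T Γ (A ⇛ B)) (h₂ : Deriv T Γ (B ⇛ A)) : Deriv T Γ (A.iff B) := by
  -- The conjunction in the equivalence is coded as a negated implication, so that implication is
  -- assumed and refuted.
  refine .impI (.impE (.impE (.hyp (A := (A ⇛ B) ⇛ (B ⇛ A).neg) (by simp [Form.neg])) ?_) ?_)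
  · exact h₁.weaken (List.subset_cons_self _ _)
  · exact h₂.weaken (List.subset_cons_self _ _)

end HigherOrder

theorem mainTheorem9 :
    HigherOrder.Proves HigherOrder.RCA0ω (HigherOrder.UADS2.iff HigherOrder.Mu2) ∧
    HigherOrder.ExplicitImp HigherOrder.RCA0ω .bound .two
      HigherOrder.UADS2Body HigherOrder.MUBody ∧
    HigherOrder.ExplicitImp HigherOrder.RCA0ω .two .bound
      HigherOrder.MUBody HigherOrder.UADS2Body :=
  ⟨.iffI HigherOrder.explicitImp_mu_of_bound.1 HigherOrder.explicitImp_bound_of_mu.1,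
    HigherOrder.explicitImp_mu_of_bound, HigherOrder.explicitImp_bound_of_mu⟩
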